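/- Let $\mathcal X$ be a real Hilbert space with its Borel $\sigma$-algebra, let $R\in\mathbb R$, and let $\mathcal D$ be a probability measure on $\mathcal X\times\{+1,-1\}$ such that $\|x\|\le R$ for $\mathcal D$-almost every $(x,y)$, and such that the $\mathcal X$-marginal of $\mathcal D$ is concentrated on a separable subset of $\mathcal X$ (automatic if $\mathcal X$ is separable). For $w\in\mathcal X$ let $F_w(x)=\langle w,x\rangle$. For $f:\mathcal X\to\mathbb R$ measurable and a sample $S=((x_1,y_1),\dots,(x_m,y_m))$ put $$L(f)=\Pr_{(x,y)\sim\mathcal D}\{yf(x)\le 0\},\qquad \hat L_\gamma(f)=\frac1m\,\bigl|\{i : y_if(x_i)<\gamma\}\bigr| .$$ Let $m\ge 8$ be an integer and $\delta\in(0,1)$. Then with probability at least $1-\delta$ over $S\sim\mathcal D^m$, the following hold simultaneously for all $w\in\mathcal X$ with $\|w\|\le 1$. (Soft margin.) For all $\gamma>0$, $$L(F_w)\le \hat L_\gamma(F_w)+\sqrt{\frac{\hat L_\gamma(F_w)\,\Delta}{m}}+\frac{\Delta+\sqrt{\Delta}+2}{m},\qquad \Delta:=2\log\frac2\delta+9\Bigl(\frac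 R\gamma\Bigr)^2\log m .$$ (Hard margin.) If $\gamma_\star=\max\{\gamma>0:\hat L_\gamma(F_w)=0\}$ exists, then $$L(F_w)\le\frac{8(R/\gamma_\star)^2\log m+\log(1/\delta)}{m}.$$ Here "with probability at least $1-\delta$" means that the samples for which all of this holds include a measurable set of $\mathcal D^m$-probability at least $1-\delta$. -/

import Mathlib

open MeasureTheory

noncomputable section

/-- The binary margin `M(f, (x, y)) = y f(x)` of a real-valued score function `f` at a labelled
example. The label set `{+1, -1}` is the type `ℤˣ` of units of `ℤ`. -/
def binaryMargin {X : Type*} (f : X → ℝ) (z : X × ℤˣ) : ℝ :=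
  ((z.2 : ℤ) : ℝ) * f z.1

/-- The margin error `L_γ(f) = Pr_{z ∼ D} {M(f, z) ≤ γ}` (non-strict inequality). -/
def marginError {X : Type*} [MeasurableSpace X] (D : Measure (X × ℤˣ)) (γ : ℝ) (f : X → ℝ) : ℝ :=
  D.real {z | binaryMargin f z ≤ γ}

/-- The misclassification loss `L(f) = L_0(f)`. -/
def misclassificationLoss {X : Type*} [MeasurableSpace X] (D : Measure (X × ℤˣ)) (f : X → ℝ) : ℝ :=
  marginError D 0 f

open Classical in
/-- The empirical margin error `m⁻¹ |{(x, y) ∈ S : y f(x) < γ}|` (strict inequality) of the sample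
`S = (z₁, …, z_m)`, counted with multiplicity. -/
def empiricalMarginError {X : Type*} {m : ℕ} (S : Fin m → X × ℤˣ) (γ : ℝ) (f : X → ℝ) : ℝ :=
  (m : ℝ)⁻¹ * ((Finset.univ.filter fun i => binaryMargin f (S i) < γ).card : ℝ)

/-- The linear predictor `F_w(x) = ⟨w, x⟩`. -/
def linearPredictor {X : Type*} [NormedAddCommGroup X] [InnerProductSpace ℝ X] (w : X) : X → ℝ :=
  fun x => inner ℝ w x

/-- `Δ = 2 log(2/δ) + 9 (R/γ)² log m`. -/
def softMarginDelta (R γ δ : ℝ) (m : ℕ) : ℝ :=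
  2 * Real.log (2 / δ) + 9 * (R / γ) ^ 2 * Real.log m

end

/-! The proof is a PAC-Bayes argument with Gaussian randomisation. Put θ = R√(2 log m) and c = 2θ/γ,
replace w by cw + g with g standard Gaussian, and call z an error when its randomised margin is at
most θ. As ‖x‖ ≤ R, the noise in the margin has variance at most R² and exceeds θ with probability
at most 1/m. Hence a point of margin ≤ 0 is an error with probability at least 1 - 1/m, and a point
of margin ≥ γ with probability at most 1/m, since cγ = 2θ. Shifting the prior costs ‖cw‖²/2 ≤
4(R/γ)² log m. Neither θ nor the prior depends on γ or w, so one event serves all of them.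

For fixed g the number k of errors in the sample is binomial with parameters m, p. The ratio of
maximal to actual likelihood has mean at most 2√m (`lintegral_likelihoodRatio_le`) and dominates
exp(mp(1 - e⁻ˢ) - sk) for every s ≥ 0 at once (`exp_le_likelihoodRatio`), so s may be chosen after
seeing the sample. Markov's inequality for the prior average and the change of measure
`integral_stdGaussianPi_add_le` yield `pacBayes_stdGaussianPi`. A quadratic optimisation in s gives
the soft bound, and s = log m the hard one.

An infinite-dimensional Hilbert space has no standard Gaussian measure, so the argument runs in
finite-dimensional spans, with bounds free of the dimension. Fatou's lemma gives one event on which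
the prior average is small for infinitely many spans, and `pacBayes_linearPredictor` passes to the
limit. -/

open MeasureTheory ProbabilityTheory Filter Topology

/-! ### Central binomial weights and Stirling bounds -/

/-- The normalized central binomial coefficient `4⁻ᵏ (2k choose k)`. -/
noncomputable def centralWeight (k : ℕ) : ℝ := (k.centralBinom : ℝ) / 4 ^ k

lemma centralWeight_zero : centralWeight 0 = 1 := by simp [centralWeight]

lemma centralWeight_pos (k : ℕ) : 0 < centralWeight k := by
  have := k.centralBinom_pos
  unfold centralWeight
  positivity

lemma succ_mul_centralWeight_succ (k : ℕ) :
    ((k : ℝ) + 1) * centralWeight (k + 1) = (k + 1 / 2) * centralWeight k := by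
  have h : ((k : ℝ) + 1) * ((k + 1).centralBinom : ℝ) = 2 * (2 * k + 1) * (k.centralBinom : ℝ) := by
    exact_mod_cast Nat.succ_mul_centralBinom_succ k
  unfold centralWeight
  rw [mul_div_assoc', h, pow_succ]
  field_simp
  ring

/-- The weights are the coefficients of (1 - x)^(-1/2), whose square is the geometric series. In
coefficients: by symmetry the first index averages to n/2, and the recurrence then shows that the
sum does not change from n to n + 1. -/
lemma sum_centralWeight_mul (n : ℕ) :
    ∑ p ∈ Finset.HasAntidiagonal.antidiagonal n, centralWeight p.1 * centralWeight p.2 = 1 := by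
  have key : ∀ n : ℕ, ∑ p ∈ Finset.HasAntidiagonal.antidiagonal n, (p.1 : ℝ) * (centralWeight p.1 * centralWeight p.2)
      = n / 2 * ∑ p ∈ Finset.HasAntidiagonal.antidiagonal n, centralWeight p.1 * centralWeight p.2 := by
    intro n
    have h1 : ∑ p ∈ Finset.HasAntidiagonal.antidiagonal n,
        (p.1 : ℝ) * (centralWeight p.1 * centralWeight p.2)
        = ∑ p ∈ Finset.HasAntidiagonal.antidiagonal n, (p.2 : ℝ) * (centralWeight p.1 * centralWeight p.2) := by
      rw [← Finset.Nat.sum_antidiagonal_swap]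
      refine Finset.sum_congr rfl fun p _ => ?_
      simp only [Prod.fst_swap, Prod.snd_swap]
      ring
    have h2 : ∑ p ∈ Finset.HasAntidiagonal.antidiagonal n, (p.1 : ℝ) * (centralWeight p.1 * centralWeight p.2)
        + ∑ p ∈ Finset.HasAntidiagonal.antidiagonal n, (p.2 : ℝ) * (centralWeight p.1 * centralWeight p.2)
        = n * ∑ p ∈ Finset.HasAntidiagonal.antidiagonal n, centralWeight p.1 * centralWeight p.2 := by
      rw [← Finset.sum_add_distrib, Finset.mul_sum]
      refine Finset.sum_congr rfl fun p hp => ?_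
      rw [← add_mul]
      congr 1
      exact_mod_cast Finset.HasAntidiagonal.mem_antidiagonal.1 hp
    linarith
  induction n with
  | zero => simp [centralWeight_zero]
  | succ n ih =>
    have h := key (n + 1)
    rw [Finset.Nat.sum_antidiagonal_succ] at h
    have h3 : ∑ p ∈ Finset.HasAntidiagonal.antidiagonal n,
        ((p.1 + 1 : ℕ) : ℝ) * (centralWeight (p.1 + 1) * centralWeight p.2)
        = (n + 1) / 2 := by
      calc _ = ∑ p ∈ Finset.HasAntidiagonal.antidiagonal n, ((p.1 : ℝ) * (centralWeight p.1 * centralWeight p.2)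
            + 1 / 2 * (centralWeight p.1 * centralWeight p.2)) := by
            refine Finset.sum_congr rfl fun p _ => ?_
            have := succ_mul_centralWeight_succ p.1
            push_cast
            rw [← mul_assoc, this]
            ring
        _ = _ := by
            rw [Finset.sum_add_distrib, key, ← Finset.mul_sum, ih]
            ring
    rw [h3] at h
    simp only [Nat.cast_zero, zero_mul, zero_add] at h
    push_cast at h
    have hn : ((n : ℝ) + 1) / 2 ≠ 0 := by positivity
    exact (mul_left_cancel₀ hn (by rw [mul_one]; exact h)).symm

/-- The square 4n · `centralWeight n`² equals 1 at n = 1 and is nondecreasing, because (n + 3/2)² ≥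
(n + 1)(n + 2). -/
lemma one_le_two_mul_sqrt_mul_centralWeight {n : ℕ} (hn : n ≠ 0) :
    1 ≤ 2 * √n * centralWeight n := by
  have key : ∀ n : ℕ, 1 ≤ 4 * ((n : ℝ) + 1) * centralWeight (n + 1) ^ 2 := by
    intro n
    induction n with
    | zero =>
      have := succ_mul_centralWeight_succ 0
      simp only [Nat.cast_zero, zero_add, one_mul, centralWeight_zero, mul_one] at this
      rw [zero_add, this]
      norm_num
    | succ n ih =>
      refine ih.trans ?_
      have h := succ_mul_centralWeight_succ (n + 1)
      push_cast at h ⊢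
      have h' : centralWeight (n + 1 + 1) = ((n : ℝ) + 1 + 1 / 2) * centralWeight (n + 1) / (n + 1 + 1) := by
        rw [← h]; field_simp
      rw [h']
      have e : 4 * ((n : ℝ) + 1 + 1)
          * (((n : ℝ) + 1 + 1 / 2) * centralWeight (n + 1) / (n + 1 + 1)) ^ 2
          = 4 * (((n : ℝ) + 1 + 1 / 2) ^ 2 / (n + 1 + 1)) * centralWeight (n + 1) ^ 2 := by
        field_simp
      rw [e]
      gcongr
      rw [le_div_iff₀ (by positivity)]
      nlinarith
  obtain ⟨k, rfl⟩ := Nat.exists_eq_succ_of_ne_zero hn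
  have h := key k
  have hp := centralWeight_pos (k + 1)
  rw [← abs_of_nonneg (a := 2 * √((k.succ : ℕ) : ℝ) * centralWeight k.succ) (by positivity),
    ← one_le_sq_iff_one_le_abs, mul_pow, mul_pow, Real.sq_sqrt (by positivity)]
  push_cast
  norm_num
  linarith

lemma stirlingSeq_pos {n : ℕ} (hn : n ≠ 0) : 0 < Stirling.stirlingSeq n :=
  lt_of_lt_of_le (by positivity) (Stirling.sqrt_pi_le_stirlingSeq hn)

lemma stirlingSeq_le {n : ℕ} (hn : n ≠ 0) : Stirling.stirlingSeq n ≤ Real.exp 1 / √2 := by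
  obtain ⟨k, rfl⟩ := Nat.exists_eq_succ_of_ne_zero hn
  rw [← Stirling.stirlingSeq_one]
  exact Stirling.stirlingSeq'_antitone (Nat.zero_le k)

lemma factorial_eq_stirlingSeq_mul {n : ℕ} (hn : n ≠ 0) :
    (n.factorial : ℝ) = Stirling.stirlingSeq n * √(2 * n) * (n / Real.exp 1) ^ n := by
  unfold Stirling.stirlingSeq
  have : (0 : ℝ) < n := by positivity
  field_simp

lemma centralWeight_eq_stirlingSeq {k : ℕ} (hk : k ≠ 0) :
    centralWeight k = Stirling.stirlingSeq (2 * k) / (Stirling.stirlingSeq k ^ 2 * √k) := by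
  have h : (k.centralBinom : ℝ) = ((2 * k).factorial : ℝ) / (k.factorial : ℝ) ^ 2 := by
    rw [Nat.centralBinom_eq_two_mul_choose, Nat.cast_choose ℝ (by omega : k ≤ 2 * k)]
    rw [show 2 * k - k = k by omega, sq]
  have hk' : (0 : ℝ) < k := by positivity
  have hs := stirlingSeq_pos hk
  have e1 : √(2 * ((2 * k : ℕ) : ℝ)) = 2 * √k := by
    push_cast
    rw [show 2 * (2 * (k : ℝ)) = 2 ^ 2 * k by ring, Real.sqrt_mul (by positivity),
      Real.sqrt_sq (by positivity)]
  have e2 : √(2 * (k : ℝ)) ^ 2 = 2 * (√k) ^ 2 := by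
    rw [Real.sq_sqrt (by positivity), Real.sq_sqrt (by positivity)]
  have e3 : (((2 * k : ℕ) : ℝ) / Real.exp 1) ^ (2 * k) = 4 ^ k * ((k / Real.exp 1) ^ k) ^ 2 := by
    push_cast
    rw [mul_div_assoc, mul_pow, pow_mul, pow_mul']
    norm_num
  unfold centralWeight
  rw [h, factorial_eq_stirlingSeq_mul (by omega : 2 * k ≠ 0), factorial_eq_stirlingSeq_mul hk,
    e1, e3, mul_pow, mul_pow, e2]
  have hq : 0 < (k / Real.exp 1) ^ k := by positivity
  have hr : 0 < √(k : ℝ) := by positivity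
  generalize (k / Real.exp 1) ^ k = q at *
  generalize √(k : ℝ) = r at *
  field_simp

lemma choose_mul_pow_eq_stirlingSeq {k l : ℕ} (hk : k ≠ 0) (hl : l ≠ 0) :
    ((k + l).choose k : ℝ) * ((k : ℝ) / (k + l : ℕ)) ^ k * ((l : ℝ) / (k + l : ℕ)) ^ l
      = Stirling.stirlingSeq (k + l) * √(2 * (k + l : ℕ))
        / (Stirling.stirlingSeq k * Stirling.stirlingSeq l * (√(2 * k) * √(2 * l))) := by
  rw [Nat.cast_choose ℝ (by omega : k ≤ k + l), Nat.add_sub_cancel_left,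
    factorial_eq_stirlingSeq_mul (by omega : k + l ≠ 0), factorial_eq_stirlingSeq_mul hk,
    factorial_eq_stirlingSeq_mul hl]
  have h1 := stirlingSeq_pos hk
  have h2 := stirlingSeq_pos hl
  have h3 : (0 : ℝ) < (k + l : ℕ) := by positivity
  have hk' : (0 : ℝ) < k := by positivity
  have hl' : (0 : ℝ) < l := by positivity
  generalize ((k + l : ℕ) : ℝ) = M at *
  simp only [div_pow, pow_add]
  field_simp

lemma exp_one_pow_three_le : Real.exp 1 ^ 3 ≤ 8 * Real.pi := by
  have h1 := Real.exp_one_lt_d9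
  have h2 := Real.pi_gt_three
  calc Real.exp 1 ^ 3 ≤ 2.72 ^ 3 := by
        gcongr
        linarith
    _ ≤ 8 * 3 := by norm_num
    _ ≤ _ := by linarith

/-- The right side is chosen because it sums exactly over k + l = m. In Stirling form all powers
cancel; bounding three Stirling terms above by e/√2 and two below by √π leaves e³ ≤ 8π. The cases k
= 0 and l = 0, outside Stirling's range, are the previous bound on a single weight. -/
lemma choose_mul_pow_le (k l : ℕ) (h : k + l ≠ 0) :
    ((k + l).choose k : ℝ) * ((k : ℝ) / (k + l : ℕ)) ^ k * ((l : ℝ) / (k + l : ℕ)) ^ l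
      ≤ 2 * √(k + l : ℕ) * (centralWeight k * centralWeight l) := by
  rcases eq_or_ne k 0 with rfl | hk
  · have hl : l ≠ 0 := by omega
    have hl' : (l : ℝ) ≠ 0 := by positivity
    simp only [zero_add, Nat.choose_zero_right, Nat.cast_one, pow_zero, mul_one, div_self hl',
      one_pow, centralWeight_zero, one_mul]
    exact one_le_two_mul_sqrt_mul_centralWeight hl
  rcases eq_or_ne l 0 with rfl | hl
  · have hk' : (k : ℝ) ≠ 0 := by positivity
    simp only [add_zero, Nat.choose_self, Nat.cast_one, pow_zero, mul_one, div_self hk',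
      one_pow, centralWeight_zero]
    exact one_le_two_mul_sqrt_mul_centralWeight hk
  rw [choose_mul_pow_eq_stirlingSeq hk hl, centralWeight_eq_stirlingSeq hk,
    centralWeight_eq_stirlingSeq hl]
  have h1 := stirlingSeq_pos hk
  have h2 := stirlingSeq_pos hl
  have h3 := stirlingSeq_pos h
  have b1 := stirlingSeq_le hk
  have b2 := stirlingSeq_le hl
  have b3 := stirlingSeq_le h
  have c1 := Stirling.sqrt_pi_le_stirlingSeq (by omega : 2 * k ≠ 0)
  have c2 := Stirling.sqrt_pi_le_stirlingSeq (by omega : 2 * l ≠ 0)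
  have d1 := stirlingSeq_pos (by omega : 2 * k ≠ 0)
  have h3' : (0 : ℝ) < (k + l : ℕ) := by positivity
  have hk' : (0 : ℝ) < k := by positivity
  have hl' : (0 : ℝ) < l := by positivity
  have key : Stirling.stirlingSeq (k + l) * Stirling.stirlingSeq k * Stirling.stirlingSeq l
      ≤ 2 * √2 * (Stirling.stirlingSeq (2 * k) * Stirling.stirlingSeq (2 * l)) := by
    have hs2 : √2 ^ 2 = (2 : ℝ) := Real.sq_sqrt (by norm_num)
    calc _ ≤ (Real.exp 1 / √2) * (Real.exp 1 / √2) * (Real.exp 1 / √2) := by gcongr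
      _ = Real.exp 1 ^ 3 / (2 * √2) := by
        rw [div_mul_div_comm, div_mul_div_comm, Real.mul_self_sqrt (by norm_num)]
        congr 1
        ring
      _ ≤ 8 * Real.pi / (2 * √2) := by gcongr; exact exp_one_pow_three_le
      _ = 2 * √2 * (√Real.pi * √Real.pi) := by
        rw [Real.mul_self_sqrt Real.pi_pos.le, div_eq_iff (by positivity)]
        linear_combination -4 * Real.pi * hs2
      _ ≤ _ := by gcongr
  generalize Stirling.stirlingSeq (k + l) = s at *
  generalize Stirling.stirlingSeq (2 * k) = s2k at *
  generalize Stirling.stirlingSeq (2 * l) = s2l at *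
  generalize Stirling.stirlingSeq k = a at *
  generalize Stirling.stirlingSeq l = b at *
  generalize ((k + l : ℕ) : ℝ) = M at *
  have p1 : 0 < √(k : ℝ) := by positivity
  have p2 : 0 < √(l : ℝ) := by positivity
  have p3 : 0 < √M := by positivity
  rw [Real.sqrt_mul (by norm_num) M, Real.sqrt_mul (by norm_num) (k : ℝ),
    Real.sqrt_mul (by norm_num) (l : ℝ)]
  have hs2 : √2 ^ 2 = (2 : ℝ) := Real.sq_sqrt (by norm_num)
  have p4 : (0 : ℝ) < √2 := by positivity
  have e1 : s * (√2 * √M) / (a * b * (√2 * √(k : ℝ) * (√2 * √(l : ℝ))))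
      = (s * a * b) * (√M / (√2 * a ^ 2 * b ^ 2 * √(k : ℝ) * √(l : ℝ))) := by
    field_simp
  have e2 : 2 * √M * (s2k / (a ^ 2 * √(k : ℝ)) * (s2l / (b ^ 2 * √(l : ℝ))))
      = (2 * √2 * (s2k * s2l)) * (√M / (√2 * a ^ 2 * b ^ 2 * √(k : ℝ) * √(l : ℝ))) := by
    field_simp
  rw [e1, e2]
  gcongr

/-! ### Maximal binomial likelihood -/

/-- The maximal value `q ↦ qᵏ (1 - q)ᵐ⁻ᵏ` of the binomial likelihood. -/
noncomputable def maxLikelihood (m k : ℕ) : ℝ :=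
  ((k : ℝ) / m) ^ k * (((m - k : ℕ) : ℝ) / m) ^ (m - k)

lemma sum_choose_mul_maxLikelihood_le {m : ℕ} (hm : m ≠ 0) :
    ∑ k ∈ Finset.range (m + 1), (m.choose k : ℝ) * maxLikelihood m k ≤ 2 * √m := by
  calc _ = ∑ p ∈ Finset.HasAntidiagonal.antidiagonal m, ((p.1 + p.2).choose p.1 : ℝ)
        * ((p.1 : ℝ) / (p.1 + p.2 : ℕ)) ^ p.1 * ((p.2 : ℝ) / (p.1 + p.2 : ℕ)) ^ p.2 := by
        rw [Finset.Nat.sum_antidiagonal_eq_sum_range_succ_mk]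
        refine Finset.sum_congr rfl fun k hk => ?_
        have : k + (m - k) = m := by
          have := Finset.mem_range.1 hk
          omega
        simp only [this, maxLikelihood, mul_assoc]
    _ ≤ ∑ p ∈ Finset.HasAntidiagonal.antidiagonal m, 2 * √m * (centralWeight p.1 * centralWeight p.2) := by
        refine Finset.sum_le_sum fun p hp => ?_
        have hp := Finset.HasAntidiagonal.mem_antidiagonal.1 hp
        have := choose_mul_pow_le p.1 p.2 (by omega)
        rwa [hp] at this ⊢
    _ = _ := by rw [← Finset.mul_sum, sum_centralWeight_mul, mul_one]

/-- This is the k-th power of x ≤ exp(x - 1) at x = am/k. -/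
lemma pow_le_div_pow_mul_exp {m : ℕ} (hm : m ≠ 0) (k : ℕ) {a : ℝ} (ha : 0 ≤ a) :
    a ^ k ≤ ((k : ℝ) / m) ^ k * Real.exp (m * a - k) := by
  rcases eq_or_ne k 0 with rfl | hk
  · simp only [pow_zero, Nat.cast_zero, sub_zero, one_mul]
    exact Real.one_le_exp (by positivity)
  have hm' : (0 : ℝ) < m := by positivity
  have hk' : (0 : ℝ) < k := by positivity
  have e : a = (k / m) * (a * m / k) := by field_simp
  have h : a * m / k ≤ Real.exp (a * m / k - 1) := by
    have := Real.add_one_le_exp (a * m / k - 1)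
    linarith
  have h2 : Real.exp (m * a - k) = Real.exp (a * m / k - 1) ^ k := by
    rw [← Real.exp_nat_mul]
    congr 1
    field_simp
  rw [h2, ← mul_pow]
  gcongr
  calc a = (k / m) * (a * m / k) := e
    _ ≤ _ := by gcongr

lemma pow_mul_pow_le_maxLikelihood_mul_exp {m k : ℕ} (hm : m ≠ 0) (hk : k ≤ m) {a b : ℝ}
    (ha : 0 ≤ a) (hb : 0 ≤ b) :
    a ^ k * b ^ (m - k) ≤ maxLikelihood m k * Real.exp (m * (a + b - 1)) := by
  calc a ^ k * b ^ (m - k)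
      ≤ (((k : ℝ) / m) ^ k * Real.exp (m * a - k))
        * ((((m - k : ℕ) : ℝ) / m) ^ (m - k) * Real.exp (m * b - (m - k : ℕ))) := by
        gcongr
        · exact pow_le_div_pow_mul_exp hm k ha
        · exact pow_le_div_pow_mul_exp hm (m - k) hb
    _ = maxLikelihood m k * (Real.exp (m * a - k) * Real.exp (m * b - (m - k : ℕ))) := by
        unfold maxLikelihood
        ring
    _ = _ := by
        rw [← Real.exp_add, Nat.cast_sub hk]
        congr 2
        ring

lemma maxLikelihood_pos {m k : ℕ} (hm : m ≠ 0) (hk : k ≤ m) : 0 < maxLikelihood m k := by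
  unfold maxLikelihood
  apply mul_pos
  · rcases eq_or_ne k 0 with rfl | h
    · simp
    · positivity
  · rcases eq_or_ne (m - k) 0 with h | h
    · simp [h]
    · positivity

lemma exp_mul_le_maxLikelihood {m k : ℕ} (hm : m ≠ 0) (hk : k ≤ m) {p s : ℝ} (h0 : 0 ≤ p)
    (h1 : p ≤ 1) :
    Real.exp (m * p * (1 - Real.exp (-s)) - s * k) * (p ^ k * (1 - p) ^ (m - k))
      ≤ maxLikelihood m k := by
  -- The success probability is tilted by e⁻ˢ without renormalising; the missing mass p(1 - e⁻ˢ)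
  -- becomes the exponent.
  have h := pow_mul_pow_le_maxLikelihood_mul_exp hm hk (a := p * Real.exp (-s)) (b := 1 - p)
    (by positivity) (by linarith)
  have e : (m : ℝ) * (p * Real.exp (-s) + (1 - p) - 1) = -(m * p * (1 - Real.exp (-s))) := by ring
  rw [e, Real.exp_neg (m * p * _), mul_pow, ← div_eq_mul_inv, le_div_iff₀ (Real.exp_pos _),
    ← Real.exp_nat_mul] at h
  refine le_trans (le_of_eq ?_) h
  rw [Real.exp_sub, div_eq_mul_inv, ← Real.exp_neg]
  rw [show (k : ℝ) * -s = -(s * k) by ring]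
  ring

/-! ### Gaussian shifts, tails and change of measure -/

/-- The standard Gaussian measure on `ℝ^ι`. -/
noncomputable def stdGaussianPi (ι : Type*) [Fintype ι] : Measure (ι → ℝ) :=
  Measure.pi fun _ => gaussianReal 0 1

instance {ι : Type*} [Fintype ι] : IsProbabilityMeasure (stdGaussianPi ι) := by
  unfold stdGaussianPi
  infer_instance

lemma gaussianReal_map_add_const_eq_withDensity (h : ℝ) :
    (gaussianReal 0 1).map (· + h)
      = (gaussianReal 0 1).withDensity fun x => ENNReal.ofReal (Real.exp (x * h - h ^ 2 / 2)) := by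
  rw [gaussianReal_map_add_const, zero_add, gaussianReal_of_var_ne_zero _ one_ne_zero,
    gaussianReal_of_var_ne_zero _ one_ne_zero,
    ← withDensity_mul _ (measurable_gaussianPDF 0 1) (by fun_prop)]
  congr 1
  ext x
  rw [Pi.mul_apply, gaussianPDF, gaussianPDF, ← ENNReal.ofReal_mul (gaussianPDFReal_nonneg _ _ _)]
  congr 1
  simp only [gaussianPDFReal, mul_assoc, ← Real.exp_add, NNReal.coe_one]
  congr 2
  ring

lemma lintegral_stdGaussianPi_prod {ι : Type*} [Fintype ι] (f : ι → ℝ → ENNReal)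
    (hf : ∀ i, Measurable (f i)) :
    ∫⁻ g, ∏ i, f i (g i) ∂stdGaussianPi ι = ∏ i, ∫⁻ x, f i x ∂gaussianReal 0 1 := by
  have hind : iIndepFun (fun i (g : ι → ℝ) => f i (g i)) (stdGaussianPi ι) :=
    iIndepFun_pi fun i => (hf i).aemeasurable
  rw [lintegral_prod_eq_prod_lintegral_of_indepFun Finset.univ _ hind
    fun i => (hf i).comp (measurable_pi_apply i)]
  refine Finset.prod_congr rfl fun i _ => ?_
  exact (measurePreserving_eval (fun _ : ι => gaussianReal 0 1) i).lintegral_comp (hf i)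

/-- Cameron–Martin formula: the one-dimensional densities multiply, and a product measure is
determined by its values on boxes. -/
lemma stdGaussianPi_map_add {ι : Type*} [Fintype ι] (h : ι → ℝ) :
    (stdGaussianPi ι).map (· + h) = (stdGaussianPi ι).withDensity fun g =>
      ENNReal.ofReal (Real.exp (∑ i, g i * h i - (∑ i, h i ^ 2) / 2)) := by
  have h1 : (stdGaussianPi ι).map (· + h)
      = Measure.pi fun i => (gaussianReal 0 1).map (· + h i) := by
    unfold stdGaussianPi
    rw [← Measure.pi_map_pi (fun i => by fun_prop)]
    rfl
  rw [h1]
  refine Measure.pi_eq fun s hs => ?_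
  rw [withDensity_apply _ (MeasurableSet.univ_pi hs),
    ← lintegral_indicator (MeasurableSet.univ_pi hs)]
  have h2 : ∀ i, (gaussianReal 0 1).map (· + h i) (s i) = ∫⁻ x, (s i).indicator
      (fun x => ENNReal.ofReal (Real.exp (x * h i - h i ^ 2 / 2))) x ∂gaussianReal 0 1 := by
    intro i
    rw [gaussianReal_map_add_const_eq_withDensity, withDensity_apply _ (hs i),
      lintegral_indicator (hs i)]
  simp_rw [h2]
  rw [← lintegral_stdGaussianPi_prod _ fun i => Measurable.indicator (by fun_prop) (hs i)]
  refine lintegral_congr fun g => ?_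
  by_cases hg : g ∈ Set.univ.pi s
  · rw [Set.indicator_of_mem hg]
    have : ∀ i, (s i).indicator (fun x => ENNReal.ofReal (Real.exp (x * h i - h i ^ 2 / 2))) (g i)
        = ENNReal.ofReal (Real.exp (g i * h i - h i ^ 2 / 2)) := fun i =>
      Set.indicator_of_mem (hg i (Set.mem_univ i)) _
    simp_rw [this]
    rw [← ENNReal.ofReal_prod_of_nonneg fun i _ => (Real.exp_pos _).le, ← Real.exp_sum,
      Finset.sum_sub_distrib, Finset.sum_div]
  · rw [Set.indicator_of_notMem hg]
    obtain ⟨i, hi⟩ : ∃ i, g i ∉ s i := by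
      by_contra! hc
      exact hg fun i _ => hc i
    exact (Finset.prod_eq_zero (Finset.mem_univ i) (Set.indicator_of_notMem hi _)).symm

lemma lintegral_stdGaussianPi_add {ι : Type*} [Fintype ι] (h : ι → ℝ) {f : (ι → ℝ) → ENNReal}
    (hf : Measurable f) :
    ∫⁻ g, f (g + h) ∂stdGaussianPi ι = ∫⁻ g, ENNReal.ofReal
      (Real.exp (∑ i, g i * h i - (∑ i, h i ^ 2) / 2)) * f g ∂stdGaussianPi ι := by
  rw [← lintegral_map (g := fun g : ι → ℝ => g + h) hf (by fun_prop), stdGaussianPi_map_add,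
    lintegral_withDensity_eq_lintegral_mul _ (by fun_prop) hf]
  rfl

lemma lintegral_stdGaussianPi_exp {ι : Type*} [Fintype ι] (a : ι → ℝ) :
    ∫⁻ g, ENNReal.ofReal (Real.exp (∑ i, g i * a i)) ∂stdGaussianPi ι
      = ENNReal.ofReal (Real.exp ((∑ i, a i ^ 2) / 2)) := by
  have h := lintegral_stdGaussianPi_add a (f := fun _ => 1) measurable_const
  simp only [lintegral_const, measure_univ, mul_one] at h
  have e : ∀ g : ι → ℝ, ENNReal.ofReal (Real.exp (∑ i, g i * a i))
      = ENNReal.ofReal (Real.exp ((∑ i, a i ^ 2) / 2))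
        * ENNReal.ofReal (Real.exp (∑ i, g i * a i - (∑ i, a i ^ 2) / 2)) := by
    intro g
    rw [← ENNReal.ofReal_mul (Real.exp_pos _).le, ← Real.exp_add]
    congr 2
    ring
  simp_rw [e]
  rw [lintegral_const_mul _ (by fun_prop), ← h, mul_one]

lemma stdGaussianPi_tail {ι : Type*} [Fintype ι] {a : ι → ℝ} {R t : ℝ} (hR : 0 < R)
    (ha : ∑ i, a i ^ 2 ≤ R ^ 2) :
    (stdGaussianPi ι).real {g | t ≤ ∑ i, g i * a i} ≤ Real.exp (-(max t 0) ^ 2 / (2 * R ^ 2)) := by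
  rcases le_total t 0 with ht | ht
  · rw [max_eq_right ht]
    simp
  rw [max_eq_left ht]
  -- Chernoff bound with exponent t/R², which is optimal for variance R².
  have hm := meas_ge_le_lintegral_div (μ := stdGaussianPi ι)
    (f := fun g => ENNReal.ofReal (Real.exp (∑ i, g i * (t / R ^ 2 * a i))))
    (Measurable.aemeasurable (by fun_prop)) (ε := ENNReal.ofReal (Real.exp (t / R ^ 2 * t)))
    (by simpa using Real.exp_pos _) ENNReal.ofReal_ne_top
  rw [lintegral_stdGaussianPi_exp, ← ENNReal.ofReal_div_of_pos (Real.exp_pos _),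
    ← Real.exp_sub] at hm
  have hsub : {g : ι → ℝ | t ≤ ∑ i, g i * a i} ⊆
      {g | ENNReal.ofReal (Real.exp (t / R ^ 2 * t))
        ≤ ENNReal.ofReal (Real.exp (∑ i, g i * (t / R ^ 2 * a i)))} := by
    intro g hg
    refine ENNReal.ofReal_le_ofReal (Real.exp_le_exp.2 ?_)
    have : ∑ i, g i * (t / R ^ 2 * a i) = t / R ^ 2 * ∑ i, g i * a i := by
      rw [Finset.mul_sum]
      exact Finset.sum_congr rfl fun i _ => by ring
    rw [this]
    exact mul_le_mul_of_nonneg_left hg (by positivity)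
  refine (ENNReal.toReal_mono ENNReal.ofReal_ne_top ((measure_mono hsub).trans hm)).trans ?_
  rw [ENNReal.toReal_ofReal (Real.exp_pos _).le]
  refine Real.exp_le_exp.2 ?_
  have e : ∑ i, (t / R ^ 2 * a i) ^ 2 = (t / R ^ 2) ^ 2 * ∑ i, a i ^ 2 := by
    rw [Finset.mul_sum]
    exact Finset.sum_congr rfl fun i _ => by ring
  rw [e]
  have h2 : (t / R ^ 2) ^ 2 * ∑ i, a i ^ 2 ≤ (t / R ^ 2) ^ 2 * R ^ 2 := by gcongr
  have h3 : (t / R ^ 2) ^ 2 * R ^ 2 / 2 - t / R ^ 2 * t = -t ^ 2 / (2 * R ^ 2) := by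
    field_simp
    ring
  linarith

lemma integrable_eval_stdGaussianPi {ι : Type*} [Fintype ι] (i : ι) :
    Integrable (fun g : ι → ℝ => g i) (stdGaussianPi ι) :=
  integrable_eval (μ := fun _ : ι => gaussianReal 0 1)
    ((memLp_id_gaussianReal 1).integrable le_rfl)

lemma integral_eval_stdGaussianPi {ι : Type*} [Fintype ι] (i : ι) :
    ∫ g : ι → ℝ, g i ∂stdGaussianPi ι = 0 := by
  unfold stdGaussianPi
  rw [integral_eval, integral_id_gaussianReal]

/-- The change of measure inequality for a translated standard Gaussian measure. -/
lemma integral_stdGaussianPi_add_le {ι : Type*} [Fintype ι] (h : ι → ℝ) {ψ : (ι → ℝ) → ℝ}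
    (hψ : Measurable ψ) {K : ℝ} (hK : ∀ g, |ψ g| ≤ K) {C : ℝ} (hC : 0 < C)
    (hle : ∫⁻ g, ENNReal.ofReal (Real.exp (ψ g)) ∂stdGaussianPi ι ≤ ENNReal.ofReal C) :
    ∫ g, ψ (g + h) ∂stdGaussianPi ι ≤ (∑ i, h i ^ 2) / 2 + Real.log C := by
  -- Here ψ at the shifted point is reduced by the log-density of the shifted measure there. So exp
  -- ξ has the same integral as exp ψ, while the mean drops by the relative entropy |h|²/2; Jensen's
  -- inequality concludes.
  set ξ : (ι → ℝ) → ℝ := fun g => ψ (g + h) - ∑ i, g i * h i - (∑ i, h i ^ 2) / 2 with hξ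
  have hψh : Measurable fun g => ψ (g + h) := hψ.comp (by fun_prop)
  have hmeas : Measurable ξ := by fun_prop
  have hint1 : Integrable (fun g => ψ (g + h)) (stdGaussianPi ι) :=
    Integrable.of_bound hψh.aestronglyMeasurable K (Filter.Eventually.of_forall fun g => hK _)
  have hint2 : Integrable (fun g : ι → ℝ => ∑ i, g i * h i) (stdGaussianPi ι) :=
    integrable_finsetSum _ fun i _ => (integrable_eval_stdGaussianPi i).mul_const _
  have hmean : ∫ g, ξ g ∂stdGaussianPi ι
      = ∫ g, ψ (g + h) ∂stdGaussianPi ι - (∑ i, h i ^ 2) / 2 := by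
    have h1 : ∫ g, ξ g ∂stdGaussianPi ι = ∫ g, ψ (g + h) - ∑ i, g i * h i ∂stdGaussianPi ι
        - ∫ _, (∑ i, h i ^ 2) / 2 ∂stdGaussianPi ι :=
      integral_sub (hint1.sub hint2) (integrable_const _)
    rw [h1, integral_sub hint1 hint2,
      integral_finsetSum _ fun i _ => (integrable_eval_stdGaussianPi i).mul_const _]
    simp [integral_mul_const, integral_eval_stdGaussianPi]
  have hlint : ∫⁻ g, ENNReal.ofReal (Real.exp (ξ g)) ∂stdGaussianPi ι ≤ ENNReal.ofReal C := by
    refine le_trans (le_of_eq ?_) hle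
    have := lintegral_stdGaussianPi_add (-h) (f := fun g => ENNReal.ofReal (Real.exp (ψ (g + h))))
      (by fun_prop)
    simp only [neg_add_cancel_right] at this
    rw [this]
    refine lintegral_congr fun g => ?_
    rw [← ENNReal.ofReal_mul (Real.exp_pos _).le, ← Real.exp_add]
    congr 2
    simp [hξ]
    ring
  have hintξ : Integrable ξ (stdGaussianPi ι) := (hint1.sub hint2).sub (integrable_const _)
  have hintexp : Integrable (fun g => Real.exp (ξ g)) (stdGaussianPi ι) := by
    refine ⟨(by fun_prop : Measurable _).aestronglyMeasurable, ?_⟩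
    rw [hasFiniteIntegral_iff_ofReal (Filter.Eventually.of_forall fun g => (Real.exp_pos _).le)]
    exact hlint.trans_lt ENNReal.ofReal_lt_top
  have hjensen : Real.exp (∫ g, ξ g ∂stdGaussianPi ι) ≤ ∫ g, Real.exp (ξ g) ∂stdGaussianPi ι :=
    convexOn_exp.map_integral_le Real.continuous_exp.continuousOn isClosed_univ
      (Filter.Eventually.of_forall fun _ => Set.mem_univ _) hintξ hintexp
  have hfin : ∫ g, Real.exp (ξ g) ∂stdGaussianPi ι ≤ C := by
    rw [integral_eq_lintegral_of_nonneg_ae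
      (Filter.Eventually.of_forall fun g => (Real.exp_pos _).le) hintexp.aestronglyMeasurable]
    exact ENNReal.toReal_le_of_le_ofReal hC.le hlint
  have := (Real.le_log_iff_exp_le hC).2 (hjensen.trans hfin)
  rw [hmean] at this
  linarith

/-! ### Likelihood ratios and the PAC-Bayes inequality -/

open Classical in
/-- The indices of the sample points that lie in `B`. -/
noncomputable def hitIndices {Z : Type*} {m : ℕ} (B : Set Z) (S : Fin m → Z) : Finset (Fin m) :=
  Finset.univ.filter fun i => S i ∈ B

/-- The ratio of the maximal likelihood of `k` successes in `m` trials to the likelihood under the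
success probability `p`. -/
noncomputable def likelihoodRatio (m : ℕ) (p : ℝ) (k : ℕ) : ENNReal :=
  ENNReal.ofReal (maxLikelihood m k) / ENNReal.ofReal (p ^ k * (1 - p) ^ (m - k))

/-- Only the left side involves s, so controlling the ratio controls all s together. If the
likelihood vanishes the ratio is infinite, since the maximal likelihood is positive. -/
lemma exp_le_likelihoodRatio {m k : ℕ} (hm : m ≠ 0) (hk : k ≤ m) {p s : ℝ} (h0 : 0 ≤ p)
    (h1 : p ≤ 1) :
    ENNReal.ofReal (Real.exp (m * p * (1 - Real.exp (-s)) - s * k)) ≤ likelihoodRatio m p k := by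
  unfold likelihoodRatio
  rw [ENNReal.le_div_iff_mul_le (Or.inr ?_) (Or.inl ENNReal.ofReal_ne_top),
    ← ENNReal.ofReal_mul (Real.exp_pos _).le]
  · exact ENNReal.ofReal_le_ofReal (exp_mul_le_maxLikelihood hm hk h0 h1)
  · simpa using maxLikelihood_pos hm hk

lemma pi_hitIndices_eq {Z : Type*} [MeasurableSpace Z] (D : Measure Z) [IsProbabilityMeasure D]
    {m : ℕ} {B : Set Z} (hB : MeasurableSet B) (T : Finset (Fin m)) :
    (Measure.pi fun _ : Fin m => D) {S | hitIndices B S = T}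
      = ENNReal.ofReal (D.real B ^ T.card * (1 - D.real B) ^ (m - T.card)) := by
  classical
  have h : {S : Fin m → Z | hitIndices B S = T}
      = Set.univ.pi fun i => if i ∈ T then B else Bᶜ := by
    ext S
    simp only [hitIndices, Finset.ext_iff, Finset.mem_filter, Finset.mem_univ, true_and,
      Set.mem_ofPred_eq, Set.mem_univ_pi]
    refine forall_congr' fun i => ?_
    split_ifs with hi <;> simp [hi]
  rw [h, Measure.pi_pi]
  have h2 : ∀ i, D (if i ∈ T then B else Bᶜ)
      = ENNReal.ofReal (if i ∈ T then D.real B else 1 - D.real B) := by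
    intro i
    split_ifs
    · rw [ofReal_measureReal]
    · rw [← probReal_compl_eq_one_sub hB, ofReal_measureReal]
  simp_rw [h2]
  have hle : D.real B ≤ 1 := measureReal_le_one
  rw [← ENNReal.ofReal_prod_of_nonneg]
  · congr 1
    rw [Finset.prod_ite, Finset.prod_const, Finset.prod_const, Finset.filter_mem_eq_inter,
      Finset.univ_inter]
    congr 2
    rw [Finset.filter_not, Finset.filter_mem_eq_inter, Finset.univ_inter,
      ← Finset.compl_eq_univ_sdiff, Finset.card_compl, Fintype.card_fin]
  · intro i _
    split_ifs
    · exact measureReal_nonneg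
    · linarith

lemma measurableSet_hitIndices_eq {Z : Type*} [MeasurableSpace Z] {m : ℕ} {B : Set Z}
    (hB : MeasurableSet B) (T : Finset (Fin m)) :
    MeasurableSet {S : Fin m → Z | hitIndices B S = T} := by
  classical
  have h : {S : Fin m → Z | hitIndices B S = T}
      = ⋂ i, {S | S i ∈ B ↔ i ∈ T} := by
    ext S
    simp [hitIndices, Finset.ext_iff]
  rw [h]
  refine MeasurableSet.iInter fun i => ?_
  by_cases hi : i ∈ T
  · simp only [hi, iff_true]
    exact (measurable_pi_apply i : Measurable fun S : Fin m → Z => S i) hB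
  · simp only [hi, iff_false]
    exact (measurable_pi_apply i : Measurable fun S : Fin m → Z => S i) hB.compl

lemma lintegral_likelihoodRatio_le {Z : Type*} [MeasurableSpace Z] (D : Measure Z)
    [IsProbabilityMeasure D] {m : ℕ} (hm : m ≠ 0) {B : Set Z} (hB : MeasurableSet B) :
    ∫⁻ S, likelihoodRatio m (D.real B) (hitIndices B S).card ∂(Measure.pi fun _ : Fin m => D)
      ≤ ENNReal.ofReal (2 * √m) := by
  classical
  have h1 : ∀ S : Fin m → Z, likelihoodRatio m (D.real B) (hitIndices B S).card
      = ∑ T : Finset (Fin m), {S | hitIndices B S = T}.indicator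
          (fun _ => likelihoodRatio m (D.real B) T.card) S := by
    intro S
    simp [Set.indicator_apply]
  simp_rw [h1]
  rw [lintegral_finsetSum _ fun T _ =>
    Measurable.indicator measurable_const (measurableSet_hitIndices_eq hB T)]
  simp_rw [lintegral_indicator_const (measurableSet_hitIndices_eq hB _), pi_hitIndices_eq D hB]
  calc _ ≤ ∑ T : Finset (Fin m), ENNReal.ofReal (maxLikelihood m T.card) := by
        refine Finset.sum_le_sum fun T _ => ?_
        -- The probability of the hit set T cancels the denominator of the ratio; when it is zero, 0
        -- · ∞ = 0 keeps the inequality.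
        rw [likelihoodRatio, mul_comm]
        exact ENNReal.mul_div_le
    _ = ENNReal.ofReal (∑ T : Finset (Fin m), maxLikelihood m T.card) := by
        rw [ENNReal.ofReal_sum_of_nonneg]
        intro T _
        exact (maxLikelihood_pos hm (by simpa using T.card_le_univ)).le
    _ ≤ _ := by
        refine ENNReal.ofReal_le_ofReal ?_
        rw [← Finset.powerset_univ, Finset.sum_powerset_apply_card]
        simpa [nsmul_eq_mul] using sum_choose_mul_maxLikelihood_le hm

lemma measurable_measureReal_slice {U Z : Type*} [MeasurableSpace U] [MeasurableSpace Z]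
    (D : Measure Z) [SFinite D] {A : Set (U × Z)} (hA : MeasurableSet A) :
    Measurable fun u => D.real {z | (u, z) ∈ A} :=
  (measurable_measure_prodMk_left hA).ennreal_toReal

lemma integral_measureReal_slice_comm {U Z : Type*} [MeasurableSpace U] [MeasurableSpace Z]
    (P : Measure U) (D : Measure Z) [IsFiniteMeasure P] [IsFiniteMeasure D] {A : Set (U × Z)}
    (hA : MeasurableSet A) :
    ∫ u, D.real {z | (u, z) ∈ A} ∂P = ∫ z, P.real {u | (u, z) ∈ A} ∂D := by
  have h1 : ∫ u, D.real {z | (u, z) ∈ A} ∂P = (∫⁻ u, D (Prod.mk u ⁻¹' A) ∂P).toReal :=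
    integral_toReal (measurable_measure_prodMk_left hA).aemeasurable
      (Filter.Eventually.of_forall fun _ => measure_lt_top _ _)
  have h2 : ∫ z, P.real {u | (u, z) ∈ A} ∂D
      = (∫⁻ z, P ((fun u => (u, z)) ⁻¹' A) ∂D).toReal :=
    integral_toReal (measurable_measure_prodMk_right hA).aemeasurable
      (Filter.Eventually.of_forall fun _ => measure_lt_top _ _)
  rw [h1, h2, ← Measure.prod_apply hA, ← Measure.prod_apply_symm hA]

lemma measurable_likelihoodRatio (m : ℕ) : Measurable (Function.uncurry (likelihoodRatio m)) := by
  have h : ∀ k, Measurable fun p : ℝ => likelihoodRatio m p k := by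
    intro k
    unfold likelihoodRatio
    fun_prop
  exact measurable_from_prod_countable_left h

lemma measurable_card_hitIndices {U Z : Type*} [MeasurableSpace U] [MeasurableSpace Z]
    {m : ℕ} {A : Set (U × Z)} (hA : MeasurableSet A) :
    Measurable fun q : U × (Fin m → Z) => (hitIndices {z | (q.1, z) ∈ A} q.2).card := by
  simp only [hitIndices, Finset.card_filter, Set.mem_ofPred_eq]
  refine Finset.measurable_sum _ fun i _ => Measurable.ite ?_ measurable_const measurable_const
  have : Measurable fun q : U × (Fin m → Z) => (q.1, q.2 i) :=
    measurable_fst.prodMk ((measurable_pi_apply i).comp measurable_snd)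
  exact this hA

lemma measurable_likelihoodRatio_comp {Ω : Type*} [MeasurableSpace Ω] (m : ℕ) {p : Ω → ℝ}
    {k : Ω → ℕ} (hp : Measurable p) (hk : Measurable k) :
    Measurable fun ω => likelihoodRatio m (p ω) (k ω) := by
  have h := (measurable_likelihoodRatio m).comp (hp.prodMk hk)
  simpa only [Function.comp_def, Function.uncurry_apply_pair] using h

lemma measurable_likelihoodRatio_hitIndices {U Z : Type*} [MeasurableSpace U] [MeasurableSpace Z]
    (D : Measure Z) [IsProbabilityMeasure D] (m : ℕ) {A : Set (U × Z)} (hA : MeasurableSet A) :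
    Measurable fun q : U × (Fin m → Z) =>
      likelihoodRatio m (D.real {z | (q.1, z) ∈ A}) (hitIndices {z | (q.1, z) ∈ A} q.2).card := by
  have hp : Measurable fun q : U × (Fin m → Z) => D.real {z | (q.1, z) ∈ A} :=
    Measurable.comp (g := fun u => D.real {z | (u, z) ∈ A}) (measurable_measureReal_slice D hA)
      measurable_fst
  have hk : Measurable fun q : U × (Fin m → Z) => (hitIndices {z | (q.1, z) ∈ A} q.2).card :=
    measurable_card_hitIndices hA
  exact measurable_likelihoodRatio_comp m hp hk

/-- The PAC-Bayes inequality for translated Gaussian posteriors, on a fixed sample. -/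
lemma pacBayes_stdGaussianPi {ι Z : Type*} [Fintype ι] [MeasurableSpace Z] (D : Measure Z)
    [IsProbabilityMeasure D] {m : ℕ} (hm : m ≠ 0) {A : Set ((ι → ℝ) × Z)} (hA : MeasurableSet A)
    {S : Fin m → Z} {C : ℝ} (hC : 0 < C)
    (hS : ∫⁻ g, likelihoodRatio m (D.real {z | (g, z) ∈ A}) (hitIndices {z | (g, z) ∈ A} S).card
      ∂stdGaussianPi ι ≤ ENNReal.ofReal C) (h : ι → ℝ) {s : ℝ} (hs : 0 ≤ s) :
    m * (1 - Real.exp (-s)) * ∫ z, (stdGaussianPi ι).real {g | (g + h, z) ∈ A} ∂D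
      - s * ∑ i, (stdGaussianPi ι).real {g | (g + h, S i) ∈ A}
      ≤ (∑ i, h i ^ 2) / 2 + Real.log C := by
  classical
  have hp : Measurable fun g : ι → ℝ => D.real {z | (g, z) ∈ A} :=
    measurable_measureReal_slice D hA
  have hk : Measurable fun g : ι → ℝ => (hitIndices {z | (g, z) ∈ A} S).card :=
    (measurable_card_hitIndices hA).comp (measurable_id.prodMk measurable_const)
  have hp0 : ∀ g : ι → ℝ, 0 ≤ D.real {z | (g, z) ∈ A} := fun g => measureReal_nonneg
  have hp1 : ∀ g : ι → ℝ, D.real {z | (g, z) ∈ A} ≤ 1 := fun g => measureReal_le_one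
  have hkm : ∀ g : ι → ℝ, (hitIndices {z | (g, z) ∈ A} S).card ≤ m := fun g => by
    simpa using (hitIndices {z | (g, z) ∈ A} S).card_le_univ
  have hes : Real.exp (-s) ≤ 1 := Real.exp_le_one_iff.2 (by linarith)
  have hes0 := Real.exp_pos (-s)
  set ψ : (ι → ℝ) → ℝ := fun g => m * D.real {z | (g, z) ∈ A} * (1 - Real.exp (-s))
    - s * ((hitIndices {z | (g, z) ∈ A} S).card : ℝ) with hψ
  have hψm : Measurable ψ := by
    have : Measurable fun g : ι → ℝ => ((hitIndices {z | (g, z) ∈ A} S).card : ℝ) :=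
      measurable_from_top.comp hk
    fun_prop
  have hbound : ∀ g, |ψ g| ≤ m + s * m := by
    intro g
    have h1 : (m : ℝ) * D.real {z | (g, z) ∈ A} * (1 - Real.exp (-s)) ≤ m * 1 * 1 := by
      have := hp1 g
      gcongr
      linarith
    have h2 : 0 ≤ (m : ℝ) * D.real {z | (g, z) ∈ A} * (1 - Real.exp (-s)) :=
      mul_nonneg (mul_nonneg (by positivity) (hp0 g)) (by linarith)
    have h3 : s * ((hitIndices {z | (g, z) ∈ A} S).card : ℝ) ≤ s * m := by
      gcongr
      exact hkm g
    have h4 : 0 ≤ s * ((hitIndices {z | (g, z) ∈ A} S).card : ℝ) := by positivity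
    rw [abs_le]
    constructor <;> simp only [hψ] <;> nlinarith
  have hle : ∫⁻ g, ENNReal.ofReal (Real.exp (ψ g)) ∂stdGaussianPi ι ≤ ENNReal.ofReal C :=
    (lintegral_mono fun g => exp_le_likelihoodRatio hm (hkm g) (hp0 g) (hp1 g)).trans hS
  have key := integral_stdGaussianPi_add_le h hψm hbound hC hle
  have hAh : MeasurableSet {q : (ι → ℝ) × Z | (q.1 + h, q.2) ∈ A} :=
    (by fun_prop : Measurable fun q : (ι → ℝ) × Z => (q.1 + h, q.2)) hA
  have hint1 : Integrable (fun g : ι → ℝ => D.real {z | (g + h, z) ∈ A}) (stdGaussianPi ι) :=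
    Integrable.of_bound (hp.comp (by fun_prop : Measurable fun g : ι → ℝ => g + h)).aestronglyMeasurable
      1 (Filter.Eventually.of_forall fun g => by
        rw [Real.norm_of_nonneg (hp0 _)]
        exact hp1 _)
  have hAhi : ∀ z, MeasurableSet {g : ι → ℝ | (g + h, z) ∈ A} := fun z =>
    (by fun_prop : Measurable fun g : ι → ℝ => (g + h, z)) hA
  have hsum : ∀ g : ι → ℝ, ((hitIndices {z | (g + h, z) ∈ A} S).card : ℝ)
      = ∑ i, {g : ι → ℝ | (g + h, S i) ∈ A}.indicator (fun _ => (1 : ℝ)) g := by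
    intro g
    simp [hitIndices, Set.indicator_apply]
  have hint2 : ∀ i, Integrable ({g : ι → ℝ | (g + h, S i) ∈ A}.indicator (fun _ => (1 : ℝ)))
      (stdGaussianPi ι) := fun i => (integrable_const _).indicator (hAhi _)
  have hfub : ∫ g, D.real {z | (g + h, z) ∈ A} ∂stdGaussianPi ι
      = ∫ z, (stdGaussianPi ι).real {g | (g + h, z) ∈ A} ∂D :=
    integral_measureReal_slice_comm (stdGaussianPi ι) D hAh
  have heq : ∫ g, ψ (g + h) ∂stdGaussianPi ι
      = m * (1 - Real.exp (-s)) * ∫ z, (stdGaussianPi ι).real {g | (g + h, z) ∈ A} ∂D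
      - s * ∑ i, (stdGaussianPi ι).real {g | (g + h, S i) ∈ A} := by
    simp only [hψ, hsum]
    rw [integral_sub ((hint1.const_mul _).mul_const _)
      ((integrable_finsetSum _ fun i _ => hint2 i).const_mul _), integral_mul_const,
      integral_const_mul, integral_const_mul, integral_finsetSum _ fun i _ => hint2 i, hfub]
    simp_rw [integral_indicator_const _ (hAhi _)]
    simp only [smul_eq_mul, mul_one]
    ring
  rwa [heq] at key

/-! ### Randomised linear predictors and finite-dimensional approximation -/

/-- The pairs `(g, z)` for which the linear predictor with coefficients `g` along `e` has margin at
most `θ` at `z`. -/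
def lowMarginSet {X ι : Type*} [NormedAddCommGroup X] [InnerProductSpace ℝ X] [Fintype ι]
    (e : ι → X) (θ : ℝ) : Set ((ι → ℝ) × (X × ℤˣ)) :=
  {q | ((q.2.2 : ℤ) : ℝ) * ∑ i, q.1 i * inner ℝ (e i) q.2.1 ≤ θ}

section

variable {X : Type*} [NormedAddCommGroup X] [InnerProductSpace ℝ X]

lemma measurable_intUnits_cast : Measurable fun y : ℤˣ => ((y : ℤ) : ℝ) :=
  measurable_from_top.comp (comap_measurable (Units.val : ℤˣ → ℤ))

lemma intUnits_cast_sq (y : ℤˣ) : ((y : ℤ) : ℝ) ^ 2 = 1 := by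
  rcases Int.units_eq_one_or y with rfl | rfl <;> simp

lemma measurableSet_lowMarginSet [MeasurableSpace X] [BorelSpace X] {ι : Type*} [Fintype ι]
    (e : ι → X) (θ : ℝ) : MeasurableSet (lowMarginSet e θ) := by
  have h1 : ∀ i, Measurable fun x : X => (inner ℝ (e i) x : ℝ) := fun i =>
    Continuous.measurable (by fun_prop)
  have h2 : Measurable fun q : (ι → ℝ) × (X × ℤˣ) =>
      ((q.2.2 : ℤ) : ℝ) * ∑ i, q.1 i * inner ℝ (e i) q.2.1 := by
    refine Measurable.mul (measurable_intUnits_cast.comp (measurable_snd.comp measurable_snd)) ?_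
    refine Finset.measurable_sum _ fun i _ => ?_
    have h3 : Measurable fun q : (ι → ℝ) × (X × ℤˣ) => q.1 i := by fun_prop
    exact h3.mul ((h1 i).comp (measurable_fst.comp measurable_snd))
  exact measurableSet_le h2 measurable_const

lemma measurable_binaryMargin_linearPredictor [MeasurableSpace X] [BorelSpace X] (w : X) :
    Measurable fun z : X × ℤˣ => binaryMargin (linearPredictor w) z := by
  have h1 : Measurable fun x : X => (inner ℝ w x : ℝ) := Continuous.measurable (by fun_prop)
  exact (measurable_intUnits_cast.comp measurable_snd).mul (h1.comp measurable_fst)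

/-- The Gaussian tail function `t ↦ exp (-t₊² / (2 R²))`. -/
noncomputable def gaussianTail (R t : ℝ) : ℝ := Real.exp (-(max t 0) ^ 2 / (2 * R ^ 2))

lemma continuous_gaussianTail (R : ℝ) : Continuous (gaussianTail R) := by
  unfold gaussianTail
  fun_prop

lemma gaussianTail_nonneg (R t : ℝ) : 0 ≤ gaussianTail R t := (Real.exp_pos _).le

lemma gaussianTail_le_one (R t : ℝ) : gaussianTail R t ≤ 1 := by
  refine Real.exp_le_one_iff.2 (div_nonpos_of_nonpos_of_nonneg ?_ (by positivity))
  have := sq_nonneg (max t 0)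
  linarith

lemma gaussianTail_antitone (R : ℝ) : Antitone (gaussianTail R) := by
  intro s t hst
  unfold gaussianTail
  gcongr

/-- This fixes the threshold θ = R√(2 log m): the noise passes it with probability at most 1/m. -/
lemma gaussianTail_mul_sqrt {R : ℝ} (hR : 0 < R) {m : ℕ} (hm : m ≠ 0) :
    gaussianTail R (R * √(2 * Real.log m)) = 1 / m := by
  have hm' : (0 : ℝ) < m := by positivity
  have hl : 0 ≤ 2 * Real.log m := by
    have : (1 : ℝ) ≤ m := by exact_mod_cast Nat.one_le_iff_ne_zero.2 hm
    have := Real.log_nonneg this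
    positivity
  unfold gaussianTail
  rw [max_eq_left (by positivity), mul_pow, Real.sq_sqrt hl]
  have : -(R ^ 2 * (2 * Real.log m)) / (2 * R ^ 2) = -Real.log m := by field_simp
  rw [this, Real.exp_neg, Real.exp_log hm', one_div]

lemma lowMarginSet_score {ι : Type*} [Fintype ι] (e : ι → X) (w : X) (c : ℝ) (z : X × ℤˣ)
    (g : ι → ℝ) :
    ((z.2 : ℤ) : ℝ) * ∑ i, (g + fun i => c * inner ℝ (e i) w) i * inner ℝ (e i) z.1
      = ∑ i, g i * (((z.2 : ℤ) : ℝ) * inner ℝ (e i) z.1)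
        + c * (((z.2 : ℤ) : ℝ) * ∑ i, inner ℝ (e i) w * inner ℝ (e i) z.1) := by
  simp only [Finset.mul_sum]
  rw [← Finset.sum_add_distrib]
  refine Finset.sum_congr rfl fun i _ => ?_
  simp only [Pi.add_apply]
  ring

lemma sum_intUnits_mul_inner_sq_le {ι : Type*} [Fintype ι] {e : ι → X}
    (he : ∀ x, ∑ i, inner ℝ (e i) x ^ 2 ≤ ‖x‖ ^ 2) {R : ℝ} (y : ℤˣ) {x : X} (hx : ‖x‖ ≤ R) :
    ∑ i, (((y : ℤ) : ℝ) * inner ℝ (e i) x) ^ 2 ≤ R ^ 2 := by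
  simp_rw [mul_pow, intUnits_cast_sq, one_mul]
  refine (he x).trans ?_
  gcongr

/-- If the randomised margin exceeds θ, the centred noise is at least θ minus the shifted margin,
and the Gaussian tail bound applies. -/
lemma le_measureReal_lowMarginSet {ι : Type*} [Fintype ι] {e : ι → X}
    (he : ∀ x, ∑ i, inner ℝ (e i) x ^ 2 ≤ ‖x‖ ^ 2) {R : ℝ} (hR : 0 < R) (w : X) (c θ : ℝ)
    (z : X × ℤˣ) (hz : ‖z.1‖ ≤ R) :
    1 - gaussianTail R (θ - c * (((z.2 : ℤ) : ℝ) * ∑ i, inner ℝ (e i) w * inner ℝ (e i) z.1))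
      ≤ (stdGaussianPi ι).real {g | (g + fun i => c * inner ℝ (e i) w, z) ∈ lowMarginSet e θ} := by
  have h1 := stdGaussianPi_tail (t := θ - c * (((z.2 : ℤ) : ℝ)
    * ∑ i, inner ℝ (e i) w * inner ℝ (e i) z.1)) hR (sum_intUnits_mul_inner_sq_le he z.2 hz)
  have h2 : (Set.univ : Set (ι → ℝ))
      ⊆ {g | (g + fun i => c * inner ℝ (e i) w, z) ∈ lowMarginSet e θ} ∪
        {g | θ - c * (((z.2 : ℤ) : ℝ) * ∑ i, inner ℝ (e i) w * inner ℝ (e i) z.1)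
          ≤ ∑ i, g i * (((z.2 : ℤ) : ℝ) * inner ℝ (e i) z.1)} := by
    intro g _
    simp only [lowMarginSet, Set.mem_union, Set.mem_ofPred_eq, lowMarginSet_score]
    rcases le_total (∑ i, g i * (((z.2 : ℤ) : ℝ) * inner ℝ (e i) z.1)
      + c * (((z.2 : ℤ) : ℝ) * ∑ i, inner ℝ (e i) w * inner ℝ (e i) z.1)) θ with h | h
    · exact Or.inl h
    · exact Or.inr (by linarith)
  have h3 := (measureReal_mono h2).trans (measureReal_union_le (μ := stdGaussianPi ι) _ _)
  rw [probReal_univ] at h3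
  unfold gaussianTail
  linarith

lemma measureReal_lowMarginSet_le {ι : Type*} [Fintype ι] {e : ι → X}
    (he : ∀ x, ∑ i, inner ℝ (e i) x ^ 2 ≤ ‖x‖ ^ 2) {R : ℝ} (hR : 0 < R) (w : X) (c θ : ℝ)
    (z : X × ℤˣ) (hz : ‖z.1‖ ≤ R) :
    (stdGaussianPi ι).real {g | (g + fun i => c * inner ℝ (e i) w, z) ∈ lowMarginSet e θ}
      ≤ gaussianTail R
        (c * (((z.2 : ℤ) : ℝ) * ∑ i, inner ℝ (e i) w * inner ℝ (e i) z.1) - θ) := by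
  have ha : ∑ i, (-(((z.2 : ℤ) : ℝ) * inner ℝ (e i) z.1)) ^ 2 ≤ R ^ 2 := by
    simpa using sum_intUnits_mul_inner_sq_le he z.2 hz
  refine (measureReal_mono ?_).trans (stdGaussianPi_tail hR ha)
  intro g hg
  simp only [lowMarginSet, Set.mem_ofPred_eq, lowMarginSet_score] at hg ⊢
  simp only [mul_neg, Finset.sum_neg_distrib]
  linarith

/-- Finite families along which all bilinear forms `⟨w, x⟩` with `x` in a separable set are
approximated, and which satisfy Bessel's inequality. -/
lemma exists_bessel_families {s : Set X} (hs : TopologicalSpace.IsSeparable s) :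
    ∃ (n : ℕ → ℕ) (e : ∀ d, Fin (n d) → X),
      (∀ d x, ∑ i, inner ℝ (e d i) x ^ 2 ≤ ‖x‖ ^ 2) ∧
      ∀ x ∈ s, ∀ w : X, Tendsto (fun d => ∑ i, inner ℝ (e d i) w * inner ℝ (e d i) x) atTop
        (𝓝 (inner ℝ w x : ℝ)) := by
  obtain ⟨c, hc, hsc⟩ := hs
  obtain ⟨x, hx⟩ : ∃ x : ℕ → X, c ⊆ Set.range x := by
    rcases c.eq_empty_or_nonempty with rfl | hne
    · exact ⟨fun _ => 0, by simp⟩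
    · obtain ⟨x, hx⟩ := hc.exists_eq_range hne
      exact ⟨x, hx.le⟩
  let V : ℕ → Submodule ℝ X := fun d => Submodule.span ℝ (x '' Set.Iio d)
  have hfin : ∀ d, FiniteDimensional ℝ (V d) := fun d =>
    FiniteDimensional.span_of_finite ℝ ((Set.finite_Iio d).image x)
  let b : ∀ d, OrthonormalBasis (Fin (Module.finrank ℝ (V d))) ℝ (V d) := fun d =>
    stdOrthonormalBasis ℝ (V d)
  have hon : ∀ d, Orthonormal ℝ fun i => (b d i : X) := fun d =>
    (b d).orthonormal.comp_linearIsometry (V d).subtypeₗᵢ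
  refine ⟨fun d => Module.finrank ℝ (V d), fun d i => b d i, fun d y => ?_, fun y hy w => ?_⟩
  · simpa using (hon d).sum_inner_products_le (s := Finset.univ) y
  -- The projection is self-adjoint, so it can be put on y alone; w need not be approximable by the
  -- spans.
  · have hproj : ∀ d, ∑ i, inner ℝ (b d i : X) w * inner ℝ (b d i : X) y
        = inner ℝ w ((V d).starProjection y) := by
      intro d
      have h := (b d).sum_inner_mul_inner ((V d).orthogonalProjectionOnto w)
        ((V d).orthogonalProjectionOnto y)
      have h1 : ∀ i (v : X), (inner ℝ (b d i) ((V d).orthogonalProjectionOnto v) : ℝ)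
          = inner ℝ (b d i : X) v := fun i v => by
        simp
      have h2 : ∀ i (v : X), (inner ℝ ((V d).orthogonalProjectionOnto v) (b d i) : ℝ)
          = inner ℝ (b d i : X) v := fun i v => by
        rw [real_inner_comm, h1]
      simp only [h1, h2] at h
      rw [h]
      simp [Submodule.inner_starProjection_left_eq_right]
    simp_rw [hproj]
    have hlim : Tendsto (fun d => (V d).starProjection y) atTop (𝓝 y) := by
      rw [Metric.tendsto_atTop]
      intro ε hε
      obtain ⟨v, hv, hyv⟩ := Metric.mem_closure_iff.1 (hsc hy) ε hε
      obtain ⟨j, rfl⟩ := hx hv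
      refine ⟨j + 1, fun d hd => ?_⟩
      have hmem : x j ∈ V d := Submodule.subset_span ⟨j, by simp; omega, rfl⟩
      rw [dist_comm, dist_eq_norm, Submodule.starProjection_minimal]
      refine lt_of_le_of_lt (ciInf_le ⟨0, ?_⟩ (⟨x j, hmem⟩ : V d)) ?_
      · rintro _ ⟨_, rfl⟩
        exact norm_nonneg _
      · rwa [← dist_eq_norm]
    exact tendsto_const_nhds.inner hlim

end

/-! ### From the exponential inequality to margin bounds -/

lemma sub_sq_div_two_le_one_sub_exp_neg {s : ℝ} (hs : 0 ≤ s) :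
    s - s ^ 2 / 2 ≤ 1 - Real.exp (-s) := by
  have h := Real.quadratic_le_exp_of_nonneg hs
  have h2 : Real.exp (-s) * Real.exp s = 1 := by rw [← Real.exp_add]; simp
  have h3 := Real.exp_pos (-s)
  -- The product equals 1 + s⁴/4.
  have h4 : 1 ≤ (1 - s + s ^ 2 / 2) * (1 + s + s ^ 2 / 2) := by
    nlinarith [sq_nonneg (s ^ 2)]
  have h5 : 0 < 1 - s + s ^ 2 / 2 := by nlinarith [sq_nonneg (s - 1)]
  have h6 : Real.exp (-s) * (1 + s + s ^ 2 / 2) ≤ 1 := by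
    calc _ ≤ Real.exp (-s) * Real.exp s := by gcongr
      _ = 1 := h2
  have h7 : 0 < 1 + s + s ^ 2 / 2 := by positivity
  nlinarith

/-- The choice s = (p - q)/p maximises p(s - s²/2) - sq, a lower bound for the left side of the
hypothesis. -/
lemma sub_sq_le_of_forall_exp {p q β : ℝ} (hq : 0 ≤ q) (hpq : q < p)
    (h : ∀ s, 0 ≤ s → p * (1 - Real.exp (-s)) - s * q ≤ β) : (p - q) ^ 2 ≤ 2 * β * p := by
  have hp : 0 < p := by linarith
  have hs : 0 ≤ (p - q) / p := div_nonneg (by linarith) hp.le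
  have h1 := h _ hs
  have h2 := mul_le_mul_of_nonneg_left (sub_sq_div_two_le_one_sub_exp_neg hs) hp.le
  have h3 : p * ((p - q) / p - ((p - q) / p) ^ 2 / 2) - (p - q) / p * q
      = (p - q) ^ 2 / (2 * p) := by
    field_simp
    ring
  have h4 : (p - q) ^ 2 / (2 * p) ≤ β := by linarith
  rw [div_le_iff₀ (by positivity)] at h4
  linarith

lemma le_add_sqrt_of_sq_le {x a q : ℝ} (ha : 0 ≤ a) (hq : 0 ≤ q) (h : x ^ 2 ≤ a * (x + q)) :
    x ≤ a + √(a * q) := by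
  by_contra! hx
  have h1 := Real.sqrt_nonneg (a * q)
  have h2 := Real.mul_self_sqrt (mul_nonneg ha hq)
  nlinarith

lemma sqrt_add_le_sqrt_add_sqrt {x y : ℝ} (hx : 0 ≤ x) (hy : 0 ≤ y) : √(x + y) ≤ √x + √y := by
  refine Real.sqrt_le_iff.2 ⟨by positivity, ?_⟩
  nlinarith [Real.sq_sqrt hx, Real.sq_sqrt hy, Real.sqrt_nonneg x, Real.sqrt_nonneg y,
    mul_nonneg (Real.sqrt_nonneg x) (Real.sqrt_nonneg y)]

/-- Since L ≤ 1, L(1 - 1/m) ≥ L - 1/m, so the hypothesis compares p = L - 1/m with q = l + 1/m.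
Solving the resulting quadratic inequality for p - q gives the bound; the two shifts by 1/m produce
the 2/m, and p ≤ q is immediate. -/
lemma soft_margin_of_forall_exp {m : ℕ} (hm : m ≠ 0) {L l B Δ : ℝ} (hL : L ≤ 1) (hl : 0 ≤ l)
    (hΔ : 2 * B ≤ Δ)
    (h : ∀ s, 0 ≤ s → m * (1 - Real.exp (-s)) * (L * (1 - 1 / m)) - s * (m * (l + 1 / m)) ≤ B) :
    L ≤ l + √(l * Δ / m) + (Δ + √Δ + 2) / m := by
  have hm' : (0 : ℝ) < m := by positivity
  have hB : 0 ≤ B := by simpa using h 0 le_rfl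
  have hΔ0 : 0 ≤ Δ := by linarith
  have hinv : (0 : ℝ) < 1 / m := by positivity
  have hsplit : (Δ + √Δ + 2) / m = Δ / m + √Δ / m + 2 * (1 / m) := by ring
  have hr1 := Real.sqrt_nonneg (l * Δ / m)
  have hr2 : 0 ≤ √Δ / m := by positivity
  have hr3 : 0 ≤ Δ / m := by positivity
  rw [hsplit]
  rcases le_or_gt (L - 1 / m) (l + 1 / m) with hle | hlt
  · linarith
  have hsq := sub_sq_le_of_forall_exp (p := L - 1 / m) (q := l + 1 / m) (β := B / m)
    (by positivity) hlt fun s hs => by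
      rw [le_div_iff₀ hm']
      refine le_trans ?_ (h s hs)
      have h1 : Real.exp (-s) ≤ 1 := Real.exp_le_one_iff.2 (by linarith)
      have h2 : L - 1 / m ≤ L * (1 - 1 / m) := by nlinarith
      have h3 : 0 ≤ m * (1 - Real.exp (-s)) := mul_nonneg hm'.le (by linarith)
      have h4 := mul_le_mul_of_nonneg_left h2 h3
      linarith
  have hp : 0 < L - 1 / m := by linarith
  have h5 : 2 * (B / m) ≤ Δ / m := by
    rw [mul_div_assoc']
    gcongr
  have h6 : (L - 1 / m - (l + 1 / m)) ^ 2
      ≤ Δ / m * (L - 1 / m - (l + 1 / m) + (l + 1 / m)) := by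
    rw [sub_add_cancel]
    exact hsq.trans (by gcongr)
  have h7 := le_add_sqrt_of_sq_le (by positivity) (by positivity) h6
  have h8 : √(Δ / m * (l + 1 / m)) ≤ √(l * Δ / m) + √Δ / m := by
    have e : Δ / m * (l + 1 / m) = l * Δ / m + Δ / m ^ 2 := by field_simp
    rw [e]
    refine (sqrt_add_le_sqrt_add_sqrt (by positivity) (by positivity)).trans ?_
    rw [Real.sqrt_div hΔ0, Real.sqrt_sq hm'.le]
  linarith

/-- At s = log m the factor 1 - e⁻ˢ is 1 - 1/m. The two such factors cost at most 2, and the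
residual empirical error 1/m costs log m. -/
lemma hard_margin_of_forall_exp {m : ℕ} (hm : m ≠ 0) {L B : ℝ} (hL0 : 0 ≤ L) (hL : L ≤ 1)
    (h : ∀ s, 0 ≤ s → m * (1 - Real.exp (-s)) * (L * (1 - 1 / m)) - s * (m * (0 + 1 / m)) ≤ B) :
    L * m ≤ B + Real.log m + 2 := by
  have hm' : (0 : ℝ) < m := by positivity
  have h1 := h (Real.log m) (Real.log_nonneg (by exact_mod_cast Nat.one_le_iff_ne_zero.2 hm))
  rw [Real.exp_neg, Real.exp_log hm'] at h1
  have h2 : m * (1 - (m : ℝ)⁻¹) * (L * (1 - 1 / m)) - Real.log m * (m * (0 + 1 / m))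
      = L * m - 2 * L + L * (1 / m) - Real.log m := by
    field_simp
    ring
  have h3 : 0 ≤ L * (1 / m) := by positivity
  linarith

/-! ### Passage to the limit and the good event -/

lemma misclassificationLoss_nonneg {X : Type*} [MeasurableSpace X] (D : Measure (X × ℤˣ))
    (f : X → ℝ) : 0 ≤ misclassificationLoss D f := measureReal_nonneg

lemma misclassificationLoss_le_one {X : Type*} [MeasurableSpace X] (D : Measure (X × ℤˣ))
    [IsProbabilityMeasure D] (f : X → ℝ) : misclassificationLoss D f ≤ 1 := measureReal_le_one

lemma empiricalMarginError_nonneg {X : Type*} {m : ℕ} (S : Fin m → X × ℤˣ) (γ : ℝ) (f : X → ℝ) :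
    0 ≤ empiricalMarginError S γ f := by
  unfold empiricalMarginError
  positivity

lemma empiricalMarginError_eq_one {X : Type*} {m : ℕ} (hm : m ≠ 0) {S : Fin m → X × ℤˣ} {γ : ℝ}
    {f : X → ℝ} (h : ∀ i, binaryMargin f (S i) < γ) : empiricalMarginError S γ f = 1 := by
  unfold empiricalMarginError
  rw [Finset.filter_true_of_mem fun i _ => h i, Finset.card_univ, Fintype.card_fin]
  have : (m : ℝ) ≠ 0 := by positivity
  field_simp

lemma binaryMargin_linearPredictor_le {X : Type*} [NormedAddCommGroup X] [InnerProductSpace ℝ X]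
    {w : X} (hw : ‖w‖ ≤ 1) (z : X × ℤˣ) : binaryMargin (linearPredictor w) z ≤ ‖z.1‖ := by
  have h1 : |(inner ℝ w z.1 : ℝ)| ≤ ‖z.1‖ :=
    (abs_real_inner_le_norm w z.1).trans (mul_le_of_le_one_left (norm_nonneg _) hw)
  refine (le_abs_self _).trans ?_
  rw [binaryMargin, linearPredictor, abs_mul]
  rcases Int.units_eq_one_or z.2 with h | h <;> simpa [h] using h1

section

variable {X : Type*} [NormedAddCommGroup X] [InnerProductSpace ℝ X] [MeasurableSpace X]
  [BorelSpace X]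

/-- The integral over the prior that controls all posteriors on a given sample. -/
noncomputable def priorIntegral (D : Measure (X × ℤˣ)) {ι : Type*} [Fintype ι] (e : ι → X) (θ : ℝ)
    {m : ℕ} (S : Fin m → X × ℤˣ) : ENNReal :=
  ∫⁻ g, likelihoodRatio m (D.real {z | (g, z) ∈ lowMarginSet e θ})
    (hitIndices {z | (g, z) ∈ lowMarginSet e θ} S).card ∂stdGaussianPi ι

lemma measurable_priorIntegral (D : Measure (X × ℤˣ)) [IsProbabilityMeasure D] {ι : Type*}
    [Fintype ι] (e : ι → X) (θ : ℝ) (m : ℕ) :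
    Measurable fun S : Fin m → X × ℤˣ => priorIntegral D e θ S :=
  (measurable_likelihoodRatio_hitIndices D m
    (measurableSet_lowMarginSet e θ)).lintegral_prod_left'

lemma lintegral_priorIntegral_le (D : Measure (X × ℤˣ)) [IsProbabilityMeasure D] {ι : Type*}
    [Fintype ι] (e : ι → X) (θ : ℝ) {m : ℕ} (hm : m ≠ 0) :
    ∫⁻ S, priorIntegral D e θ S ∂(Measure.pi fun _ : Fin m => D) ≤ ENNReal.ofReal (2 * √m) := by
  unfold priorIntegral
  have hmeas : Measurable (Function.uncurry fun (S : Fin m → X × ℤˣ) (g : ι → ℝ) =>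
      likelihoodRatio m (D.real {z | (g, z) ∈ lowMarginSet e θ})
        (hitIndices {z | (g, z) ∈ lowMarginSet e θ} S).card) := by
    have h := (measurable_likelihoodRatio_hitIndices D m
      (measurableSet_lowMarginSet e θ)).comp measurable_swap
    simpa only [Function.uncurry_def, Function.comp_def, Prod.fst_swap, Prod.snd_swap] using h
  rw [lintegral_lintegral_swap hmeas.aemeasurable]
  refine (lintegral_mono (g := fun _ => ENNReal.ofReal (2 * √m)) fun g =>
    lintegral_likelihoodRatio_le D hm ?_).trans (by simp)
  exact measurable_prodMk_left (measurableSet_lowMarginSet e θ)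

lemma misclassificationLoss_mul_le_integral (D : Measure (X × ℤˣ)) [IsProbabilityMeasure D]
    {R : ℝ} (hR : 0 < R) {m : ℕ} (hm : m ≠ 0) (w : X) {c : ℝ} (hc : 0 ≤ c) :
    misclassificationLoss D (linearPredictor w) * (1 - 1 / m)
      ≤ ∫ z, {z | binaryMargin (linearPredictor w) z ≤ 0}.indicator (fun z => 1 - gaussianTail R
        (R * √(2 * Real.log m) - c * binaryMargin (linearPredictor w) z)) z ∂D := by
  have hB : MeasurableSet {z : X × ℤˣ | binaryMargin (linearPredictor w) z ≤ 0} :=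
    measurableSet_le (measurable_binaryMargin_linearPredictor w) measurable_const
  have h1 : misclassificationLoss D (linearPredictor w) * (1 - 1 / m)
      = ∫ z, {z | binaryMargin (linearPredictor w) z ≤ 0}.indicator
        (fun _ => 1 - 1 / (m : ℝ)) z ∂D := by
    rw [integral_indicator_const _ hB, smul_eq_mul]
    rfl
  rw [h1]
  have hmeas : Measurable fun z : X × ℤˣ => 1 - gaussianTail R
        (R * √(2 * Real.log m) - c * binaryMargin (linearPredictor w) z) :=
    measurable_const.sub ((continuous_gaussianTail R).measurable.comp
      (measurable_const.sub ((measurable_binaryMargin_linearPredictor w).const_mul c)))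
  refine integral_mono ((integrable_const _).indicator hB) ?_ fun z => ?_
  · refine Integrable.indicator (Integrable.of_bound hmeas.aestronglyMeasurable 1
      (Eventually.of_forall fun z => ?_)) hB
    rw [Real.norm_of_nonneg (sub_nonneg.2 (gaussianTail_le_one _ _))]
    have := gaussianTail_nonneg R (R * √(2 * Real.log m) - c * binaryMargin (linearPredictor w) z)
    linarith
  · refine Set.indicator_le_indicator' fun hz => ?_
    rw [← gaussianTail_mul_sqrt hR hm]
    refine sub_le_sub_left (gaussianTail_antitone R ?_) _
    have : c * binaryMargin (linearPredictor w) z ≤ 0 := mul_nonpos_of_nonneg_of_nonpos hc hz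
    linarith

/-- The limit of the PAC-Bayes inequalities along finite families that exhaust a separable set. -/
lemma pacBayes_linearPredictor (D : Measure (X × ℤˣ)) [IsProbabilityMeasure D] {s : Set X}
    (hs : ∀ᵐ z ∂D, z.1 ∈ s) {R : ℝ} (hR0 : 0 < R) (hR : ∀ᵐ z ∂D, ‖z.1‖ ≤ R) {n : ℕ → ℕ}
    {e : ∀ d, Fin (n d) → X} (he : ∀ d x, ∑ i, inner ℝ (e d i) x ^ 2 ≤ ‖x‖ ^ 2)
    (hlim : ∀ x ∈ s, ∀ w : X, Tendsto (fun d => ∑ i, inner ℝ (e d i) w * inner ℝ (e d i) x) atTop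
        (𝓝 (inner ℝ w x : ℝ))) {m : ℕ} (hm : m ≠ 0) {S : Fin m → X × ℤˣ}
    (hSR : ∀ i, ‖(S i).1‖ ≤ R) (hSs : ∀ i, (S i).1 ∈ s) {C : ℝ} (hC : 0 < C)
    (hfreq : ∃ᶠ d in atTop, priorIntegral D (e d) (R * √(2 * Real.log m)) S ≤ ENNReal.ofReal C)
    {w : X} (hw : ‖w‖ ≤ 1) {γ : ℝ} (hγ : 0 < γ) {t : ℝ} (ht : 0 ≤ t) :
    m * (1 - Real.exp (-t)) * (misclassificationLoss D (linearPredictor w) * (1 - 1 / m))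
      - t * (m * (empiricalMarginError S γ (linearPredictor w) + 1 / m))
      ≤ (2 * (R * √(2 * Real.log m)) / γ) ^ 2 / 2 + Real.log C := by
  classical
  set θ := R * √(2 * Real.log m) with hθ
  set c := 2 * θ / γ with hc
  have hθ0 : 0 ≤ θ := by positivity
  have hc0 : 0 ≤ c := by positivity
  have hm' : (0 : ℝ) < m := by positivity
  have het : 0 ≤ m * (1 - Real.exp (-t)) :=
    mul_nonneg hm'.le (sub_nonneg.2 (Real.exp_le_one_iff.2 (by linarith)))
  set u : X × ℤˣ → ℝ := fun z => binaryMargin (linearPredictor w) z with hu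
  set v : ℕ → X × ℤˣ → ℝ := fun d z =>
    ((z.2 : ℤ) : ℝ) * ∑ i, inner ℝ (e d i) w * inner ℝ (e d i) z.1 with hv
  have hvlim : ∀ z : X × ℤˣ, z.1 ∈ s → Tendsto (fun d => v d z) atTop (𝓝 (u z)) :=
    fun z hz => (hlim z.1 hz w).const_mul _
  set B : Set (X × ℤˣ) := {z | u z ≤ 0} with hBdef
  have hB : MeasurableSet B :=
    measurableSet_le (measurable_binaryMargin_linearPredictor w) measurable_const
  have hvm : ∀ d, Measurable (v d) := by
    intro d
    have h1 : ∀ i, Measurable fun x : X => (inner ℝ (e d i) x : ℝ) := fun i =>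
      Continuous.measurable (by fun_prop)
    exact (measurable_intUnits_cast.comp measurable_snd).mul (Finset.measurable_sum _ fun i _ =>
      ((h1 i).comp measurable_fst).const_mul _)
  -- The indicator uses the limiting margin u, and only the continuous tail sees the approximation v
  -- d. No convergence of indicators is needed, here or in `G`.
  let F : ℕ → X × ℤˣ → ℝ := fun d => B.indicator fun z => 1 - gaussianTail R (θ - c * v d z)
  have hFm : ∀ d, Measurable (F d) := fun d => Measurable.indicator
    (measurable_const.sub ((continuous_gaussianTail R).measurable.comp
      (measurable_const.sub ((hvm d).const_mul c)))) hB
  have hFb : ∀ d z, ‖F d z‖ ≤ 1 := by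
    intro d z
    refine (norm_indicator_le_norm_self _ _).trans ?_
    rw [Real.norm_of_nonneg (sub_nonneg.2 (gaussianTail_le_one _ _))]
    have := gaussianTail_nonneg R (θ - c * v d z)
    linarith
  have hFlim : Tendsto (fun d => ∫ z, F d z ∂D) atTop
      (𝓝 (∫ z, B.indicator (fun z => 1 - gaussianTail R (θ - c * u z)) z ∂D)) := by
    refine tendsto_integral_of_dominated_convergence (fun _ => 1)
      (fun d => (hFm d).aestronglyMeasurable) (integrable_const _)
      (fun d => Eventually.of_forall (hFb d)) ?_
    filter_upwards [hs] with z hz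
    by_cases hzB : z ∈ B
    · simp only [F, Set.indicator_of_mem hzB]
      exact (((continuous_gaussianTail R).tendsto _).comp
        (((hvlim z hz).const_mul c).const_sub θ)).const_sub 1
    · simp only [F, Set.indicator_of_notMem hzB]
      exact tendsto_const_nhds
  let G : ℕ → ℝ := fun d => ∑ i, if u (S i) < γ then 1 else gaussianTail R (c * v d (S i) - θ)
  have hGlim : Tendsto G atTop
      (𝓝 (∑ i, if u (S i) < γ then 1 else gaussianTail R (c * u (S i) - θ))) := by
    refine tendsto_finsetSum _ fun i _ => ?_
    split_ifs
    · exact tendsto_const_nhds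
    · exact ((continuous_gaussianTail R).tendsto _).comp
        (((hvlim _ (hSs i)).const_mul c).sub_const θ)
  have hineq : ∃ᶠ d in atTop, m * (1 - Real.exp (-t)) * ∫ z, F d z ∂D - t * G d
      ≤ c ^ 2 / 2 + Real.log C := by
    refine hfreq.mono fun d hd => ?_
    have hA := measurableSet_lowMarginSet (e d) θ
    have key := pacBayes_stdGaussianPi D hm hA hC hd (fun i => c * inner ℝ (e d i) w) ht
    -- Bessel's inequality makes the cost of the shift independent of the dimension.
    have hh : ∑ i, (c * inner ℝ (e d i) w) ^ 2 ≤ c ^ 2 := by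
      simp_rw [mul_pow]
      rw [← Finset.mul_sum]
      refine mul_le_of_le_one_right (sq_nonneg c) ((he d w).trans ?_)
      exact pow_le_one₀ (norm_nonneg _) hw
    have hp : ∫ z, F d z ∂D ≤ ∫ z, (stdGaussianPi (Fin (n d))).real
        {g | (g + fun i => c * inner ℝ (e d i) w, z) ∈ lowMarginSet (e d) θ} ∂D := by
      refine integral_mono_ae (Integrable.of_bound (hFm d).aestronglyMeasurable 1
        (Eventually.of_forall (hFb d))) ?_ ?_
      · have hAh : MeasurableSet {q : (X × ℤˣ) × (Fin (n d) → ℝ) |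
            (q.2 + fun i => c * inner ℝ (e d i) w, q.1) ∈ lowMarginSet (e d) θ} :=
          ((measurable_snd.add_const _).prodMk measurable_fst) hA
        exact Integrable.of_bound (measurable_measureReal_slice _ hAh).aestronglyMeasurable 1
          (Eventually.of_forall fun z => by
            rw [Real.norm_of_nonneg measureReal_nonneg]
            exact measureReal_le_one)
      · filter_upwards [hR] with z hz
        by_cases hzB : z ∈ B
        · simp only [F, Set.indicator_of_mem hzB]
          exact le_measureReal_lowMarginSet (he d) hR0 w c θ z hz
        · simp only [F, Set.indicator_of_notMem hzB]
          exact measureReal_nonneg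
    have hk : ∑ i, (stdGaussianPi (Fin (n d))).real
        {g | (g + fun i => c * inner ℝ (e d i) w, S i) ∈ lowMarginSet (e d) θ} ≤ G d := by
      refine Finset.sum_le_sum fun i _ => ?_
      split_ifs
      · exact measureReal_le_one
      · exact measureReal_lowMarginSet_le (he d) hR0 w c θ (S i) (hSR i)
    have h1 := mul_le_mul_of_nonneg_left hp het
    have h2 := mul_le_mul_of_nonneg_left hk ht
    linarith
  have hfinal := le_of_tendsto_of_frequently
    ((hFlim.const_mul (m * (1 - Real.exp (-t)))).sub (hGlim.const_mul t)) hineq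
  have hloss := mul_le_mul_of_nonneg_left
    (misclassificationLoss_mul_le_integral D hR0 hm w hc0) het
  have hemp : (∑ i, if u (S i) < γ then 1 else gaussianTail R (c * u (S i) - θ))
      ≤ m * (empiricalMarginError S γ (linearPredictor w) + 1 / m) := by
    calc (∑ i, if u (S i) < γ then 1 else gaussianTail R (c * u (S i) - θ))
        ≤ ∑ i, ((if u (S i) < γ then 1 else 0) + 1 / (m : ℝ)) := by
          refine Finset.sum_le_sum fun i _ => ?_
          split_ifs with h
          · have : (0 : ℝ) ≤ 1 / m := by positivity
            linarith
          · rw [zero_add, ← gaussianTail_mul_sqrt hR0 hm]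
            refine gaussianTail_antitone R ?_
            have h1 : c * γ = 2 * θ := by
              rw [hc]
              field_simp
            have h2 := mul_le_mul_of_nonneg_left (not_lt.1 h) hc0
            linarith
      _ = _ := by
          rw [Finset.sum_add_distrib, Finset.sum_const, Finset.card_univ, Fintype.card_fin,
            nsmul_eq_mul, mul_add, empiricalMarginError, ← mul_assoc, mul_inv_cancel₀ hm'.ne',
            one_mul, Finset.sum_boole]
  have h2 := mul_le_mul_of_nonneg_left hemp ht
  linarith

end

/-- Each prior integral has mean at most 2√m, hence so does their liminf by Fatou's lemma. Markov's
inequality applied to the liminf gives one event for the whole sequence, at the price of a bound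
valid only for infinitely many d. -/
lemma exists_event_frequently_priorIntegral_le {X : Type*} [NormedAddCommGroup X]
    [InnerProductSpace ℝ X] [MeasurableSpace X] [BorelSpace X] (D : Measure (X × ℤˣ))
    [IsProbabilityMeasure D] {s : Set X} (hsc : IsClosed s) (hs : ∀ᵐ z ∂D, z.1 ∈ s) {R : ℝ}
    (hR : ∀ᵐ z ∂D, ‖z.1‖ ≤ R) {n : ℕ → ℕ} (e : ∀ d, Fin (n d) → X) (θ : ℝ) {m : ℕ} (hm : m ≠ 0)
    {δ : ℝ} (hδ : 0 < δ) :
    ∃ E : Set (Fin m → X × ℤˣ), MeasurableSet E ∧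
      1 - δ ≤ (Measure.pi fun _ : Fin m => D).real E ∧
      ∀ S ∈ E, (∀ i, ‖(S i).1‖ ≤ R) ∧ (∀ i, (S i).1 ∈ s) ∧
        ∃ᶠ d in atTop, priorIntegral D (e d) θ S ≤ ENNReal.ofReal (2 * √m / δ) := by
  have hm' : (0 : ℝ) < m := by positivity
  set C := 2 * √m / δ with hC
  have hC0 : 0 < C := by positivity
  set ψ : (Fin m → X × ℤˣ) → ENNReal :=
    fun S => liminf (fun d => priorIntegral D (e d) θ S) atTop with hψ
  have hψm : Measurable ψ := Measurable.liminf fun d => measurable_priorIntegral D (e d) θ m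
  have hint : ∫⁻ S, ψ S ∂(Measure.pi fun _ : Fin m => D) ≤ ENNReal.ofReal (2 * √m) := by
    refine (lintegral_liminf_le fun d => measurable_priorIntegral D (e d) θ m).trans ?_
    refine (liminf_le_liminf (Eventually.of_forall fun d =>
      lintegral_priorIntegral_le D (e d) θ hm)).trans ?_
    rw [liminf_const]
  have hE1 : MeasurableSet {S | ψ S < ENNReal.ofReal C} := measurableSet_lt hψm measurable_const
  have hgood : MeasurableSet {z : X × ℤˣ | ‖z.1‖ ≤ R ∧ z.1 ∈ s} := by
    have h1 : IsClosed {x : X | ‖x‖ ≤ R ∧ x ∈ s} :=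
      (isClosed_le continuous_norm continuous_const).inter hsc
    exact measurable_fst h1.measurableSet
  have hE2 : MeasurableSet {S : Fin m → X × ℤˣ | ∀ i, ‖(S i).1‖ ≤ R ∧ (S i).1 ∈ s} := by
    have h1 : {S : Fin m → X × ℤˣ | ∀ i, ‖(S i).1‖ ≤ R ∧ (S i).1 ∈ s}
        = Set.univ.pi fun _ => {z : X × ℤˣ | ‖z.1‖ ≤ R ∧ z.1 ∈ s} := by
      ext S
      simp
    rw [h1]
    exact MeasurableSet.univ_pi fun _ => hgood
  have hae : ∀ᵐ S ∂(Measure.pi fun _ : Fin m => D), ∀ i, ‖(S i).1‖ ≤ R ∧ (S i).1 ∈ s := by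
    rw [ae_all_iff]
    intro i
    exact (measurePreserving_eval (fun _ : Fin m => D) i).quasiMeasurePreserving.ae (hR.and hs)
  refine ⟨{S | ψ S < ENNReal.ofReal C} ∩ {S | ∀ i, ‖(S i).1‖ ≤ R ∧ (S i).1 ∈ s},
    hE1.inter hE2, ?_, fun S hS => ⟨fun i => (hS.2 i).1, fun i => (hS.2 i).2, ?_⟩⟩
  · have h1 : (Measure.pi fun _ : Fin m => D).real ({S | ψ S < ENNReal.ofReal C}
        ∩ {S | ∀ i, ‖(S i).1‖ ≤ R ∧ (S i).1 ∈ s})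
        = (Measure.pi fun _ : Fin m => D).real {S | ψ S < ENNReal.ofReal C} := by
      refine measureReal_congr ?_
      filter_upwards [hae] with S hS
      refine propext ⟨fun h => h.1, fun h => ⟨h, hS⟩⟩
    rw [h1]
    have h2 : (Measure.pi fun _ : Fin m => D) {S | ψ S < ENNReal.ofReal C}ᶜ
        ≤ ENNReal.ofReal δ := by
      have h3 : {S | ψ S < ENNReal.ofReal C}ᶜ = {S | ENNReal.ofReal C ≤ ψ S} := by
        ext S
        simp
      rw [h3]
      refine (meas_ge_le_lintegral_div hψm.aemeasurable (by simpa using hC0)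
        ENNReal.ofReal_ne_top).trans ?_
      refine (ENNReal.div_le_div_right hint _).trans ?_
      rw [← ENNReal.ofReal_div_of_pos hC0]
      refine ENNReal.ofReal_le_ofReal (le_of_eq ?_)
      rw [hC]
      field_simp
    have h4 : (Measure.pi fun _ : Fin m => D).real {S | ψ S < ENNReal.ofReal C}ᶜ ≤ δ :=
      ENNReal.toReal_le_of_le_ofReal hδ.le h2
    rw [probReal_compl_eq_one_sub hE1] at h4
    linarith
  · exact (frequently_lt_of_liminf_lt (by isBoundedDefault) hS.1).mono fun d hd => hd.le

/-! ### The constants of the theorem -/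

lemma softMarginDelta_nonneg (R γ : ℝ) {δ : ℝ} (hδ0 : 0 < δ) (hδ1 : δ < 1) (m : ℕ) :
    0 ≤ softMarginDelta R γ δ m := by
  have h1 : 0 ≤ Real.log (2 / δ) := Real.log_nonneg (by rw [le_div_iff₀ hδ0]; linarith)
  have h2 := Real.log_natCast_nonneg m
  unfold softMarginDelta
  positivity

lemma complexity_eq {R γ δ : ℝ} (hδ : 0 < δ) {m : ℕ} (hm : m ≠ 0) :
    (2 * (R * √(2 * Real.log m)) / γ) ^ 2 / 2 + Real.log (2 * √m / δ)
      = 4 * (R / γ) ^ 2 * Real.log m + Real.log m / 2 + Real.log 2 + Real.log (1 / δ) := by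
  have hm' : (0 : ℝ) < m := by positivity
  have h1 : √(2 * Real.log m) ^ 2 = 2 * Real.log m :=
    Real.sq_sqrt (mul_nonneg zero_le_two (Real.log_natCast_nonneg m))
  rw [Real.log_div (by positivity) hδ.ne', Real.log_mul (by norm_num) (by positivity),
    Real.log_sqrt hm'.le, one_div, Real.log_inv]
  rw [div_pow, mul_pow, mul_pow, h1, div_pow]
  ring

theorem mainTheorem2 {X : Type*} [NormedAddCommGroup X] [InnerProductSpace ℝ X] [CompleteSpace X]
    [MeasurableSpace X] [BorelSpace X]
    (D : Measure (X × ℤˣ)) [IsProbabilityMeasure D]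
    (hsep : ∃ s : Set X, TopologicalSpace.IsSeparable s ∧ ∀ᵐ z ∂D, z.1 ∈ s)
    (R : ℝ) (hR : ∀ᵐ z ∂D, ‖z.1‖ ≤ R)
    (m : ℕ) (hm : 8 ≤ m) (δ : ℝ) (hδ0 : 0 < δ) (hδ1 : δ < 1) :
    ∃ E : Set (Fin m → X × ℤˣ), MeasurableSet E ∧
      1 - δ ≤ (Measure.pi fun _ : Fin m => D).real E ∧
      ∀ S ∈ E, ∀ w : X, ‖w‖ ≤ 1 →
        (∀ γ : ℝ, 0 < γ →
          misclassificationLoss D (linearPredictor w) ≤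
            empiricalMarginError S γ (linearPredictor w)
              + √(empiricalMarginError S γ (linearPredictor w) * softMarginDelta R γ δ m / m)
              + (softMarginDelta R γ δ m + √(softMarginDelta R γ δ m) + 2) / m) ∧
        (∀ γstar : ℝ,
          IsGreatest {γ : ℝ | 0 < γ ∧ empiricalMarginError S γ (linearPredictor w) = 0} γstar →
          misclassificationLoss D (linearPredictor w) ≤
            (8 * (R / γstar) ^ 2 * Real.log m + Real.log (1 / δ)) / m) := by
  obtain ⟨s, hs, hsD⟩ := hsep
  -- The closure of s is still separable and, being closed, is measurable.
  obtain ⟨n, e, he, hlim⟩ := exists_bessel_families hs.closure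
  have hsD' : ∀ᵐ z ∂D, z.1 ∈ closure s := hsD.mono fun z hz => subset_closure hz
  have hm0 : m ≠ 0 := by omega
  have hm' : (0 : ℝ) < m := by positivity
  obtain ⟨E, hE, hE1, hE2⟩ := exists_event_frequently_priorIntegral_le D isClosed_closure hsD' hR e
    (R * √(2 * Real.log m)) hm0 hδ0
  refine ⟨E, hE, hE1, fun S hS w hw => ?_⟩
  obtain ⟨hSR, hSs, hfreq⟩ := hE2 S hS
  have hlog8 : 3 * Real.log 2 ≤ Real.log m := by
    have h1 : Real.log ((2 : ℝ) ^ 3) ≤ Real.log m :=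
      Real.log_le_log (by norm_num) (by norm_num; exact_mod_cast hm)
    simpa using h1
  have hlog2 := Real.log_two_gt_d9
  -- For γ > R every sample point falls below the margin, so the soft bound is trivial and no hard
  -- margin exceeds R. Otherwise 0 < γ ≤ R, which also supplies R > 0.
  have hone : ∀ γ, R < γ → empiricalMarginError S γ (linearPredictor w) = 1 := fun γ hγ =>
    empiricalMarginError_eq_one hm0 fun i =>
      ((binaryMargin_linearPredictor_le hw (S i)).trans (hSR i)).trans_lt hγ
  have hratio : ∀ γ, 0 < γ → γ ≤ R → Real.log m ≤ (R / γ) ^ 2 * Real.log m := by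
    intro γ hγ hγR
    exact le_mul_of_one_le_left (by linarith) (one_le_pow₀ ((one_le_div hγ).2 hγR))
  have hL0 := misclassificationLoss_nonneg D (linearPredictor w)
  have hL1 := misclassificationLoss_le_one D (linearPredictor w)
  have key : ∀ γ, 0 < γ → γ ≤ R → ∀ t, 0 ≤ t →
      m * (1 - Real.exp (-t)) * (misclassificationLoss D (linearPredictor w) * (1 - 1 / m))
        - t * (m * (empiricalMarginError S γ (linearPredictor w) + 1 / m))
        ≤ 4 * (R / γ) ^ 2 * Real.log m + Real.log m / 2 + Real.log 2 + Real.log (1 / δ) := by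
    intro γ hγ hγR t ht
    rw [← complexity_eq hδ0 hm0]
    exact pacBayes_linearPredictor D hsD' (hγ.trans_le hγR) hR he hlim hm0 hSR hSs
      (by positivity) hfreq hw hγ ht
  refine ⟨fun γ hγ => ?_, fun γ hγ => ?_⟩
  · rcases lt_or_ge R γ with hRγ | hγR
    · have h0 := softMarginDelta_nonneg R γ hδ0 hδ1 m
      rw [hone γ hRγ]
      have h1 : 0 ≤ √(1 * softMarginDelta R γ δ m / m) := Real.sqrt_nonneg _
      have h2 : 0 ≤ (softMarginDelta R γ δ m + √(softMarginDelta R γ δ m) + 2) / m := by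
        positivity
      linarith
    · refine soft_margin_of_forall_exp hm0 hL1 (empiricalMarginError_nonneg S γ _) ?_
        (key γ hγ hγR)
      -- Doubling the complexity gives 8(R/γ)² log m + log m; as R ≥ γ, the last term is absorbed
      -- into the constant 9.
      have h1 := hratio γ hγ hγR
      have h2 : Real.log (2 / δ) = Real.log 2 + Real.log (1 / δ) := by
        rw [← Real.log_mul (by norm_num) (by positivity)]
        congr 1
        ring
      unfold softMarginDelta
      rw [h2]
      linarith
  · obtain ⟨hγ0, hemp⟩ := hγ.1
    have hγR : γ ≤ R := by
      by_contra! h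
      rw [hone γ h] at hemp
      exact one_ne_zero hemp
    have h1 := key γ hγ0 hγR
    rw [hemp] at h1
    have h2 := hard_margin_of_forall_exp hm0 hL0 hL1 h1
    -- It remains to fit (3/2) log m + log 2 + 2 into 4(R/γ)² log m, which follows from R ≥ γ and
    -- log m ≥ 3 log 2.
    have h3 := hratio γ hγ0 hγR
    rw [le_div_iff₀ hm']
    linarith
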